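/- Let $n\ge 2$. Let $\mathbb T_n^o$ be the (finite) set of isomorphism classes of finite rooted (non-plane, unlabelled) trees with $n$ leaves in which no vertex other than possibly the root has degree two; a leaf is a vertex of degree one different from the root. Let $\mathbb T_n^{b,o}\subset\mathbb T_n^o$ be the subset of binary trees, i.e. those whose root has degree one and whose other vertices all have degree one or three. Let $(\tau_k)_{k\ge 0}$ be the time-homogeneous Markov chain on $\mathbb T_n^o$ whose transition from $T$ to $\widetilde T$ is as follows. 1. Choose an edge of $T$ uniformly at random, subdivide it by a new vertex and attach a new leaf to this vertex. This gives a tree $T_{+1}$ with $n+1$ leaves and root $\rho$. 2. Choose an ordered pair $(\Sigma,\widetilde\Sigma)$ of distinct leaves of $T_{+1}$ uniformly at random. Let $\Omega$ be the last common vertex of the paths from $\rho$ to $\Sigma$ and to $\widetilde\Sigma$ (possibly $\Omega=\rho$), and let $R$ be the union of these two paths. For a vertex $x$ of $R$ let $S_x$ be the (possibly trivial) tree rooted at $x$ formed by $x$ and the components of $T_{+1}\setminus R$ attached at $x$. 3. Allocate the labels $2,\dots,n$ to the other $n-1$ leaves by a uniformly random bijection. Let $Y_j$ be the vertex $x$ of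 $R$ such that the leaf with label $j$ lies in $S_x$. 4. Consider the branches $E_1=[[\rho,\Omega[[$, $E_2=]]\Omega,\Sigma[[$, $E_3=[[\Omega,\widetilde\Sigma[[$, each viewed as a list of vertices ordered by increasing distance from $\rho$ (so $\rho\in E_1$ if $\rho\neq\Omega$, and $\Omega\in E_3$). For $j=2,\dots,n$ in turn: if $Y_j$ lies on what remains of some $E_i$, remove from $E_i$ its initial part up to and including $Y_j$ and append this part to the merged list; otherwise do nothing. Form a new spine starting at the root, along the merged list: each vertex of the list other than $\rho$ and $\Omega$ is joined by one edge to its predecessor on the spine (the root, if it is the first), whereas $\rho$ and $\Omega$ are identified with their predecessor on the spine (with the root, if they come first). Finally join the leaf $\Sigma$ by one edge to the last vertex of the spine, and replant each tree $S_x$ at the position of $x$ on the new spine (trees at identified positions are joined at their roots). The leaf $\widetilde\Sigma$ is lost, and the resulting tree, with leaf labels forgotten, is $\widetilde T\in\mathbb T_n^o$. Then $\mathbb T_n^{b,o}$ is a closed communicating class of this chain, and it is the only one. Moreover, the chain has a unique stationary distribution $\pi$ on $\mathbb T_n^o$, the support of $\pi$ is $\mathbb T_n^{b,o}$, and for every initial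 distribution on $\mathbb T_n^o$ the distribution of $\tau_k$ converges to $\pi$ as $k\to\infty$. -/

import Mathlib

/-- A finite rooted plane tree: the root vertex, followed by the list of the subtrees hanging off
it (one edge leads from the root to the root vertex of each of these subtrees). -/
inductive RTree : Type
  | node : List RTree → RTree

namespace RTree

/-- The subtrees that hang off the root vertex. -/
def children : RTree → List RTree
  | node ts => ts

/-- Vertices are addressed by words: the empty word is the root, and `x ++ [i]` is the `i`-th child
of `x`. `t.sub x` is the subtree above the vertex `x` (including `x`), if `x` is a vertex of `t`. -/
def sub : RTree → List ℕ → Option RTree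
  | t, [] => some t
  | t, i :: x => t.children[i]?.bind fun s => sub s x

/-- A leaf is a vertex different from the root without children. -/
def IsLeaf (t : RTree) (x : List ℕ) : Prop := x ≠ [] ∧ t.sub x = some (node [])

/-- An edge is identified with its endpoint further away from the root, that is, with a vertex
different from the root. -/
def IsEdge (t : RTree) (x : List ℕ) : Prop := x ≠ [] ∧ (t.sub x).isSome

/-- The set of leaves. -/
def Leaf (t : RTree) : Type := {x : List ℕ // t.IsLeaf x}

/-- The set of edges. -/
def Edge (t : RTree) : Type := {x : List ℕ // t.IsEdge x}

/-- The number of leaves. -/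
noncomputable def numLeaves (t : RTree) : ℕ := Nat.card t.Leaf

/-- No vertex other than the root has degree two. A vertex different from the root has one neighbour
more than it has children, so this says that it does not have exactly one child. -/
def NoDegreeTwo (t : RTree) : Prop :=
  ∀ x s, x ≠ [] → t.sub x = some s → s.children.length ≠ 1

/-- Binary rooted trees (without degree-two vertices): the root has degree one and every other
vertex has degree one or three. -/
def IsBinary (t : RTree) : Prop :=
  t.children.length = 1 ∧
    ∀ x s, x ≠ [] → t.sub x = some s → s.children.length = 0 ∨ s.children.length = 2

/-- Isomorphism of rooted trees, disregarding the plane structure: the subtrees above the root can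
be matched by a bijection in such a way that matched subtrees are isomorphic. -/
inductive Iso : RTree → RTree → Prop
  | node (ts us : List RTree) (σ : Fin ts.length ≃ Fin us.length)
      (h : ∀ i, Iso (ts.get i) (us.get (σ i))) : Iso (node ts) (node us)

/-! ### Leaf insertion -/

/-- Insert a leaf at the edge below the vertex with the given address: the edge is subdivided by a
new vertex, to which a new leaf is attached. -/
def insertLeaf : RTree → List ℕ → RTree
  | t, [] => node [t, node []]
  | t, i :: x => node (t.children.modify i fun s => insertLeaf s x)

/-! ### Branch merging -/

/-- The longest common prefix of two addresses, that is, the last common vertex of the paths from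
the root to two vertices. -/
def meet : List ℕ → List ℕ → List ℕ
  | i :: x, j :: y => if i = j then i :: meet x y else []
  | _, _ => []

/-- The projection of the vertex `r` onto the reduced tree spanned by the root, `p` and `q`: the
last vertex on the path from the root to `r` that lies on this reduced tree. -/
def proj (p q r : List ℕ) : List ℕ :=
  if (meet p r).length ≤ (meet q r).length then meet q r else meet p r

/-- For a vertex `x` of the reduced tree of `t` spanned by the root, `p` and `q`: the list of the
subtrees of `t` that are attached at `x` and do not belong to this reduced tree. -/
def hanging (t : RTree) (p q x : List ℕ) : List RTree :=
  match t.sub x with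
  | none => []
  | some u => ((List.finRange u.children.length).filter fun i : Fin _ =>
      ¬ (x ++ [(i : ℕ)]) <+: p ∧ ¬ (x ++ [(i : ℕ)]) <+: q).map u.children.get

/-- The vertices on the three branches `[[ρ, Ω[[`, `]]Ω, p[[` and `[[Ω, q[[` of the reduced tree
spanned by the root `ρ`, `p` and `q`, each listed in order of increasing distance from the root;
here `Ω` is the branch point of the paths from `ρ` to `p` and `q`. -/
def branches (p q : List ℕ) : List (List (List ℕ)) :=
  let a := (meet p q).length
  [(List.range a).map fun k => p.take k,
   (List.range' (a + 1) (p.length - (a + 1))).map fun k => p.take k,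
   (List.range' a (q.length - a)).map fun k => q.take k]

/-- The part of the branch `A` up to and including `x`, if `x` lies on it (otherwise empty). -/
def cutOff (x : List ℕ) (A : List (List ℕ)) : List (List ℕ) :=
  if x ∈ A then A.take (A.idxOf x + 1) else []

/-- The part of the branch `A` after `x`, if `x` lies on it (otherwise all of `A`). -/
def remaining (x : List ℕ) (A : List (List ℕ)) : List (List ℕ) :=
  if x ∈ A then A.drop (A.idxOf x + 1) else A

/-- Merging of disjoint branches by a sequence of vertices. If the next vertex of the sequence lies
on what remains of one of the branches, it is a cut point: the part of that branch up to and
including the cut point is cut off and appended to the merged branch. Otherwise it is skipped.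
What is left in the end is appended. -/
def mergeBranches : List (List (List ℕ)) → List (List ℕ) → List (List ℕ)
  | E, [] => E.flatten
  | E, x :: xs => E.flatMap (cutOff x) ++ mergeBranches (E.map (remaining x)) xs

/-- Replant subtrees on a spine. `spine` lists old vertices in order of increasing distance from
the root; the old vertex `x` carries the subtrees `S x`. If `glue x` holds, `x` is identified with
its predecessor on the spine (the root, if it comes first); otherwise a new edge leads from its
predecessor to `x`. At the end of the spine there is a leaf. The result is the list of the subtrees
attached at the starting point. -/
def replant (S : List ℕ → List RTree) (glue : List ℕ → Prop) [DecidablePred glue] :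
    List (List ℕ) → List RTree
  | [] => [node []]
  | x :: xs => if glue x then S x ++ replant S glue xs else [node (S x ++ replant S glue xs)]

/-- Branch merging of `t` with respect to the leaves `p = Σ₁` (kept) and `q` (lost), where `labels`
lists the leaves that carry the labels `2, 3, …`. The left endpoints `ρ` of `[[ρ, Ω[[` and `Ω` of
`[[Ω, q[[` belong to their branches; on the merged spine they are at distance zero from the end
of the piece that precedes the one that they start, hence the subtrees attached there are joined
with those of the preceding vertex, or are attached at the root if there is none. Every other vertex
on the three branches is at distance one from its predecessor on the merged spine. (When all leaves
other than `p` and `q` are labelled, the vertices left over by the merging carry no subtree and are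
glued, so that they do not contribute.) -/
def branchMerge (t : RTree) (p q : List ℕ) (labels : List (List ℕ)) : RTree :=
  node (replant (hanging t p q) (fun x => x = [] ∨ x = meet p q)
    (mergeBranches (branches p q) (labels.map (proj p q))))

end RTree
namespace RTree

theorem induct {P : RTree → Prop} (h : ∀ ts, (∀ s ∈ ts, P s) → P (node ts)) : ∀ t, P t
  | node ts => h ts fun s _ => induct h s
decreasing_by
  have := List.sizeOf_lt_of_mem ‹_›
  simp only [node.sizeOf_spec]; omega

theorem sub_nil (t : RTree) : t.sub [] = some t := by
  cases t; rfl

theorem sub_node_cons (ts : List RTree) (i : ℕ) (x : List ℕ) :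
    (node ts).sub (i :: x) = ts[i]?.bind fun s => s.sub x := rfl

theorem sub_cons_of_lt {ts : List RTree} {i : ℕ} (hi : i < ts.length) (x : List ℕ) :
    (node ts).sub (i :: x) = ts[i].sub x := by
  simp [sub_node_cons, hi]

theorem lt_of_sub_cons {ts : List RTree} {i : ℕ} {x : List ℕ} {u : RTree}
    (h : (node ts).sub (i :: x) = some u) : ∃ hi : i < ts.length, ts[i].sub x = some u := by
  rw [sub_node_cons] at h
  by_cases hi : i < ts.length
  · exact ⟨hi, by simpa [hi] using h⟩
  · simp [List.getElem?_eq_none (not_lt.1 hi)] at h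

theorem finite_vertices (t : RTree) : {x | (t.sub x).isSome}.Finite := by
  induction t using induct with
  | h ts ih =>
    have : {x | ((node ts).sub x).isSome} ⊆ {[]} ∪
        ⋃ i : Fin ts.length, List.cons (i : ℕ) '' {x | (ts[i].sub x).isSome} := by
      rintro (_ | ⟨i, x⟩) hx
      · simp
      · obtain ⟨u, hu⟩ := Option.isSome_iff_exists.1 hx
        obtain ⟨hi, hu⟩ := lt_of_sub_cons hu
        refine Or.inr (Set.mem_iUnion.2 ⟨⟨i, hi⟩, x, ?_, rfl⟩)
        simp [hu]
    exact ((Set.finite_singleton _).union (Set.finite_iUnion fun i =>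
      (ih _ (List.getElem_mem _)).image _)).subset this

instance finite_edge (t : RTree) : Finite t.Edge :=
  (t.finite_vertices.subset fun _ hx => hx.2).to_subtype

instance finite_leaf (t : RTree) : Finite t.Leaf :=
  (t.finite_vertices.subset fun x (hx : t.IsLeaf x) => by simp [hx.2]).to_subtype

/-- The number of childless vertices, including the root. -/
noncomputable def tips (t : RTree) : ℕ := Nat.card {x // t.sub x = some (node [])}

/-- The number of childless vertices of a list of trees. -/
noncomputable def tipsList (ts : List RTree) : ℕ := (ts.map tips).sum

instance finite_tips (t : RTree) : Finite {x // t.sub x = some (node [])} :=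
  (t.finite_vertices.subset fun x (hx : t.sub x = some (node [])) => by simp [hx]).to_subtype

theorem tipsList_eq_sum (ts : List RTree) : tipsList ts = ∑ i : Fin ts.length, ts[i].tips := by
  rw [tipsList, ← List.sum_ofFn]
  congr 1
  apply List.ext_getElem <;> simp

theorem numLeaves_node (ts : List RTree) : (node ts).numLeaves = tipsList ts := by
  rw [tipsList_eq_sum]
  have e : (Σ i : Fin ts.length, {x // ts[i].sub x = some (node [])}) ≃ (node ts).Leaf := by
    refine Equiv.ofBijective (fun z => ⟨(z.1 : ℕ) :: z.2.1, by simp, ?_⟩) ⟨?_, ?_⟩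
    · rw [sub_cons_of_lt z.1.2]; exact z.2.2
    · rintro ⟨i, x, hx⟩ ⟨j, y, hy⟩ h
      have h' := List.cons.inj (congrArg Subtype.val h)
      obtain rfl : i = j := Fin.ext h'.1
      obtain rfl : x = y := h'.2
      rfl
    · rintro ⟨_ | ⟨i, x⟩, h1, h2⟩
      · exact absurd rfl h1
      · obtain ⟨hi, hu⟩ := lt_of_sub_cons h2
        exact ⟨⟨⟨i, hi⟩, x, hu⟩, rfl⟩
  rw [numLeaves, ← Nat.card_congr e, Nat.card_sigma]
  rfl

theorem tips_leaf : (node []).tips = 1 := by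
  have : ∀ x, (node []).sub x = some (node []) ↔ x = [] := by
    rintro (_ | ⟨i, x⟩)
    · simp [sub_nil]
    · simp [sub_node_cons]
  simp [tips, this]

theorem tips_node {ts : List RTree} (h : ts ≠ []) : (node ts).tips = tipsList ts := by
  rw [← numLeaves_node, tips, numLeaves, Leaf]
  refine Nat.card_congr (Equiv.subtypeEquivRight fun x => ⟨fun hx => ⟨?_, hx⟩, fun hx => hx.2⟩)
  rintro rfl
  simp [sub_nil, h] at hx

theorem tipsList_cons (t : RTree) (ts : List RTree) :
    tipsList (t :: ts) = t.tips + tipsList ts := by simp [tipsList]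

theorem tipsList_append (ts us : List RTree) :
    tipsList (ts ++ us) = tipsList ts + tipsList us := by simp [tipsList]

/-- No vertex, including the root, has exactly one child. -/
def Reduced (t : RTree) : Prop := ∀ x s, t.sub x = some s → s.children.length ≠ 1

theorem reduced_node (ts : List RTree) :
    (node ts).Reduced ↔ ts.length ≠ 1 ∧ ∀ s ∈ ts, s.Reduced := by
  constructor
  · intro h
    refine ⟨h [] _ (sub_nil _), fun s hs x u hu => ?_⟩
    obtain ⟨i, hi, rfl⟩ := List.getElem_of_mem hs
    exact h (i :: x) u (by rw [sub_cons_of_lt hi, hu])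
  · rintro ⟨h1, h2⟩ (_ | ⟨i, x⟩) u hu
    · rw [sub_nil, Option.some.injEq] at hu
      subst hu; exact h1
    · obtain ⟨hi, hu⟩ := lt_of_sub_cons hu
      exact h2 _ (List.getElem_mem _) x u hu

theorem noDegreeTwo_node (ts : List RTree) :
    (node ts).NoDegreeTwo ↔ ∀ s ∈ ts, s.Reduced := by
  constructor
  · intro h s hs x u hu
    obtain ⟨i, hi, rfl⟩ := List.getElem_of_mem hs
    exact h (i :: x) u (by simp) (by rw [sub_cons_of_lt hi, hu])
  · rintro h2 (_ | ⟨i, x⟩) u hx hu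
    · exact absurd rfl hx
    · obtain ⟨hi, hu⟩ := lt_of_sub_cons hu
      exact h2 _ (List.getElem_mem _) x u hu

theorem Reduced.sub {t u : RTree} {x : List ℕ} (h : t.Reduced) (hu : t.sub x = some u) :
    u.Reduced := by
  induction x generalizing t with
  | nil => rw [sub_nil, Option.some.injEq] at hu; exact hu ▸ h
  | cons i x ih =>
    obtain ⟨ts⟩ := t
    obtain ⟨hi, hu⟩ := lt_of_sub_cons hu
    exact ih (((reduced_node ts).1 h).2 _ (List.getElem_mem hi)) hu

/-! ### Leaf insertion keeps the class of trees and adds one leaf -/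

theorem tipsList_modify (f : RTree → RTree) (ts : List RTree) (i : ℕ) (hi : i < ts.length)
    (hf : (f ts[i]).tips = ts[i].tips + 1) : tipsList (ts.modify i f) = tipsList ts + 1 := by
  induction ts generalizing i with
  | nil => simp at hi
  | cons t ts ih =>
    cases i with
    | zero => simp only [List.modify_zero_cons, tipsList_cons]; simp at hf; omega
    | succ i =>
      simp only [List.modify_succ_cons, tipsList_cons]
      rw [ih i (by simpa using hi) (by simpa using hf)]; omega

theorem mem_modify {f : RTree → RTree} {ts : List RTree} {i : ℕ} {s : RTree}
    (h : s ∈ ts.modify i f) : s ∈ ts ∨ ∃ u ∈ ts, s = f u := by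
  obtain ⟨j, hj, rfl⟩ := List.getElem_of_mem h
  rw [List.getElem_modify]
  split
  · exact Or.inr ⟨_, List.getElem_mem _, rfl⟩
  · exact Or.inl (List.getElem_mem _)

theorem tips_insertLeaf (t : RTree) (e : List ℕ) (he : (t.sub e).isSome) :
    (t.insertLeaf e).tips = t.tips + 1 := by
  induction e generalizing t with
  | nil => rw [insertLeaf, tips_node (by simp)]; simp [tipsList, tips_leaf]
  | cons i e ih =>
    obtain ⟨ts⟩ := t
    obtain ⟨u, hu⟩ := Option.isSome_iff_exists.1 he
    obtain ⟨hi, hu⟩ := lt_of_sub_cons hu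
    have h0 : ts ≠ [] := by rintro rfl; simp at hi
    have h1 : ts.modify i (fun s => insertLeaf s e) ≠ [] := by
      intro h; apply h0; simpa using congrArg List.length h
    rw [insertLeaf, children, tips_node h1, tips_node h0]
    exact tipsList_modify _ ts i hi (ih _ (by simp [hu]))

theorem numLeaves_insertLeaf (t : RTree) (e : List ℕ) (he : t.IsEdge e) :
    (t.insertLeaf e).numLeaves = t.numLeaves + 1 := by
  obtain ⟨ts⟩ := t
  obtain _ | ⟨i, e⟩ := e
  · exact absurd rfl he.1
  · obtain ⟨u, hu⟩ := Option.isSome_iff_exists.1 he.2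
    obtain ⟨hi, hu⟩ := lt_of_sub_cons hu
    rw [insertLeaf, children, numLeaves_node, numLeaves_node]
    exact tipsList_modify _ ts i hi (tips_insertLeaf _ _ (by simp [hu]))

theorem Reduced.insertLeaf {t : RTree} (h : t.Reduced) (e : List ℕ) :
    (t.insertLeaf e).Reduced := by
  induction e generalizing t with
  | nil =>
    rw [RTree.insertLeaf, reduced_node]
    refine ⟨by simp, fun s hs => ?_⟩
    rcases List.mem_pair.1 hs with rfl | rfl
    · exact h
    · simp [reduced_node]
  | cons i e ih =>
    obtain ⟨ts⟩ := t
    rw [reduced_node] at h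
    rw [RTree.insertLeaf, children, reduced_node]
    refine ⟨by simpa using h.1, fun s hs => ?_⟩
    obtain hs | ⟨u, hu, rfl⟩ := mem_modify hs
    · exact h.2 s hs
    · exact ih (h.2 u hu)

theorem NoDegreeTwo.insertLeaf {t : RTree} (h : t.NoDegreeTwo) {e : List ℕ} (he : t.IsEdge e) :
    (t.insertLeaf e).NoDegreeTwo := by
  obtain ⟨ts⟩ := t
  obtain _ | ⟨i, e⟩ := e
  · exact absurd rfl he.1
  · rw [noDegreeTwo_node] at h
    rw [RTree.insertLeaf, children, noDegreeTwo_node]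
    intro s hs
    obtain hs | ⟨u, hu, rfl⟩ := mem_modify hs
    · exact h s hs
    · exact (h u hu).insertLeaf e

/-! ### Branch merging keeps the class of trees and loses one leaf -/

theorem flatten_perm (E : List (List (List ℕ))) (x : List ℕ) :
    (E.flatMap (cutOff x) ++ (E.map (remaining x)).flatten).Perm E.flatten := by
  induction E with
  | nil => simp
  | cons A E ih =>
    have hA : cutOff x A ++ remaining x A = A := by
      unfold cutOff remaining; split <;> simp
    simp only [List.flatMap_cons, List.map_cons, List.flatten_cons]
    calc (cutOff x A ++ E.flatMap (cutOff x) ++ (remaining x A ++ (E.map (remaining x)).flatten)).Perm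
          (cutOff x A ++ remaining x A ++ (E.flatMap (cutOff x) ++ (E.map (remaining x)).flatten)) := by
          simp only [List.append_assoc]
          refine List.Perm.append_left _ ?_
          rw [← List.append_assoc, ← List.append_assoc]
          exact List.perm_append_comm.append_right _
      _ |>.Perm _ := by rw [hA]; exact ih.append_left _

theorem mergeBranches_perm (E : List (List (List ℕ))) (xs : List (List ℕ)) :
    (mergeBranches E xs).Perm E.flatten := by
  induction xs generalizing E with
  | nil => exact List.Perm.refl _
  | cons x xs ih => exact ((ih _).append_left _).trans (flatten_perm E x)

theorem tipsList_replant (S : List ℕ → List RTree) (glue : List ℕ → Prop) [DecidablePred glue]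
    (xs : List (List ℕ)) :
    tipsList (replant S glue xs) = (xs.map fun x => tipsList (S x)).sum + 1 := by
  have hne : ∀ xs, replant S glue xs ≠ [] := by
    intro xs
    induction xs with
    | nil => simp [replant]
    | cons x xs ih => unfold replant; split <;> simp [ih]
  induction xs with
  | nil => simp [replant, tipsList, tips_leaf]
  | cons x xs ih =>
    unfold replant
    split
    · simp only [tipsList_append, ih, List.map_cons, List.sum_cons]; omega
    · rw [tipsList_cons, tips_node (by simp [hne]), tipsList_append, ih]
      simp [tipsList]; omega

theorem reduced_replant (S : List ℕ → List RTree) (glue : List ℕ → Prop) [DecidablePred glue]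
    (xs : List (List ℕ)) (h1 : ∀ x ∈ xs, ∀ s ∈ S x, s.Reduced)
    (h2 : ∀ x ∈ xs, ¬ glue x → S x ≠ []) : ∀ s ∈ replant S glue xs, s.Reduced := by
  have hne : ∀ xs, replant S glue xs ≠ [] := by
    intro xs
    induction xs with
    | nil => simp [replant]
    | cons x xs ih => unfold replant; split <;> simp [ih]
  induction xs with
  | nil => simp [replant, reduced_node]
  | cons x xs ih =>
    have ih := ih (fun y hy => h1 y (List.mem_cons_of_mem _ hy))
      (fun y hy => h2 y (List.mem_cons_of_mem _ hy))
    have hall : ∀ s ∈ S x ++ replant S glue xs, s.Reduced := by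
      intro s hs
      rcases List.mem_append.1 hs with hs | hs
      · exact h1 x (by simp) s hs
      · exact ih s hs
    unfold replant
    split
    · exact hall
    · next hg =>
      intro s hs
      obtain rfl := List.mem_singleton.1 hs
      refine (reduced_node _).2 ⟨?_, hall⟩
      have a := List.length_pos_iff.2 (h2 x (by simp) hg)
      have b := List.length_pos_iff.2 (hne xs)
      simp only [List.length_append]; omega

end RTree
namespace RTree

theorem meet_cons_self (i : ℕ) (p q : List ℕ) : meet (i :: p) (i :: q) = i :: meet p q := by
  simp [meet]

theorem meet_cons_of_ne {i j : ℕ} (h : i ≠ j) (p q : List ℕ) : meet (i :: p) (j :: q) = [] := by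
  simp [meet, h]

theorem branches_cons_self (i : ℕ) (p q : List ℕ) :
    (branches (i :: p) (i :: q)).flatten = [] :: (branches p q).flatten.map (List.cons i) := by
  simp [branches, meet_cons_self, List.range_succ_eq_map, List.range'_eq_map_range,
    Function.comp_def, Nat.add_right_comm, Nat.add_sub_add_right]

theorem branches_cons_of_ne {i j : ℕ} (h : i ≠ j) (p q : List ℕ) :
    (branches (i :: p) (j :: q)).flatten =
      (List.range p.length).map (fun k => i :: p.take k) ++
        [] :: (List.range q.length).map (fun k => j :: q.take k) := by
  simp [branches, meet_cons_of_ne h, List.range_succ_eq_map, List.range'_eq_map_range,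
    Function.comp_def, Nat.add_comm 1]

theorem hanging_cons_self {ts : List RTree} {i : ℕ} (hi : i < ts.length) (p q x : List ℕ) :
    hanging (node ts) (i :: p) (i :: q) (i :: x) = hanging ts[i] p q x := by
  simp [hanging, sub_cons_of_lt hi]

theorem hanging_cons_left {ts : List RTree} {i j : ℕ} (hi : i < ts.length) (h : i ≠ j)
    (p q x : List ℕ) :
    hanging (node ts) (i :: p) (j :: q) (i :: x) = hanging ts[i] p p x := by
  simp [hanging, sub_cons_of_lt hi, h]

theorem hanging_cons_right {ts : List RTree} {i j : ℕ} (hj : j < ts.length) (h : i ≠ j)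
    (p q x : List ℕ) :
    hanging (node ts) (i :: p) (j :: q) (j :: x) = hanging ts[j] q q x := by
  simp [hanging, sub_cons_of_lt hj, h.symm]

theorem hanging_nil (ts : List RTree) (i j : ℕ) (p q : List ℕ) :
    hanging (node ts) (i :: p) (j :: q) [] =
      ((List.finRange ts.length).filter fun k : Fin _ => (k : ℕ) ≠ i ∧ (k : ℕ) ≠ j).map ts.get := by
  simp [hanging, sub_nil, children]

theorem tipsList_hanging_nil (ts : List RTree) (i j : ℕ) (p q : List ℕ) :
    tipsList (hanging (node ts) (i :: p) (j :: q) []) =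
      ∑ k : Fin ts.length, if (k : ℕ) ≠ i ∧ (k : ℕ) ≠ j then ts[k].tips else 0 := by
  rw [hanging_nil, tipsList, List.map_map, ← Finset.sum_filter, Finset.sum,
    ← Multiset.sum_coe]
  rfl

theorem tips_same {ts : List RTree} {i : ℕ} (hi : i < ts.length) (p q : List ℕ) :
    tipsList (hanging (node ts) (i :: p) (i :: q) []) + ts[i].tips = (node ts).tips := by
  rw [tips_node (by rintro rfl; simp at hi), tipsList_hanging_nil, tipsList_eq_sum,
    ← Finset.add_sum_erase _ _ (Finset.mem_univ (⟨i, hi⟩ : Fin ts.length)),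
    ← Finset.add_sum_erase Finset.univ (fun k : Fin ts.length => ts[k].tips)
      (Finset.mem_univ (⟨i, hi⟩ : Fin ts.length))]
  rw [Finset.sum_congr rfl fun k hk => if_pos ?_]
  · simp; omega
  · have := Finset.ne_of_mem_erase hk
    simpa [Fin.ext_iff] using this

theorem tips_diff {ts : List RTree} {i j : ℕ} (hi : i < ts.length) (hj : j < ts.length)
    (h : i ≠ j) (p q : List ℕ) :
    tipsList (hanging (node ts) (i :: p) (j :: q) []) + ts[i].tips + ts[j].tips =
      (node ts).tips := by
  have hm : (⟨j, hj⟩ : Fin ts.length) ∈ Finset.univ.erase (⟨i, hi⟩ : Fin ts.length) := by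
    simp [h.symm]
  rw [tips_node (by rintro rfl; simp at hi), tipsList_hanging_nil, tipsList_eq_sum,
    ← Finset.add_sum_erase _ _ (Finset.mem_univ (⟨i, hi⟩ : Fin ts.length)),
    ← Finset.add_sum_erase _ _ hm,
    ← Finset.add_sum_erase Finset.univ (fun k : Fin ts.length => ts[k].tips)
      (Finset.mem_univ (⟨i, hi⟩ : Fin ts.length)),
    ← Finset.add_sum_erase _ (fun k : Fin ts.length => ts[k].tips) hm]
  rw [Finset.sum_congr rfl fun k hk => if_pos ?_]
  · simp; omega
  · have h1 := Finset.ne_of_mem_erase hk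
    have h2 := Finset.ne_of_mem_erase (Finset.mem_of_mem_erase hk)
    simp only [ne_eq, Fin.ext_iff] at h1 h2
    exact ⟨h2, h1⟩

theorem sum_path {t : RTree} {p : List ℕ} (hp : t.sub p = some (node [])) :
    ((List.range p.length).map fun k => tipsList (hanging t p p (p.take k))).sum + 1 =
      t.tips := by
  induction p generalizing t with
  | nil =>
    rw [sub_nil, Option.some.injEq] at hp
    simp [hp, tips_leaf]
  | cons i p ih =>
    obtain ⟨ts⟩ := t
    obtain ⟨hi, hu⟩ := lt_of_sub_cons hp
    have := ih hu
    rw [← tips_same hi p p, ← this]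
    simp only [List.length_cons, List.range_succ_eq_map, List.map_cons, List.map_map,
      Function.comp_def, List.take_succ_cons, List.take_zero, List.sum_cons,
      hanging_cons_self hi]
    omega

theorem sum_branches {t : RTree} {p q : List ℕ} (hp : t.sub p = some (node []))
    (hq : t.sub q = some (node [])) (hpq : p ≠ q) :
    ((branches p q).flatten.map fun x => tipsList (hanging t p q x)).sum + 2 = t.tips := by
  induction p generalizing t q with
  | nil =>
    rw [sub_nil, Option.some.injEq] at hp
    subst hp
    cases q with
    | nil => exact absurd rfl hpq
    | cons j q => simp [sub_node_cons] at hq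
  | cons i p ih =>
    obtain ⟨ts⟩ := t
    obtain ⟨hi, hu⟩ := lt_of_sub_cons hp
    cases q with
    | nil =>
      rw [sub_nil, Option.some.injEq, node.injEq] at hq
      subst hq; simp at hi
    | cons j q =>
      obtain ⟨hj, hv⟩ := lt_of_sub_cons hq
      by_cases h : i = j
      · subst h
        have := ih hu hv (by simpa using hpq)
        rw [← tips_same hi p q, ← this, branches_cons_self]
        simp only [List.map_cons, List.map_map, Function.comp_def, List.sum_cons,
          hanging_cons_self hi]
        omega
      · have h1 := sum_path hu
        have h2 := sum_path hv
        rw [← tips_diff hi hj h p q, ← h1, ← h2, branches_cons_of_ne h]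
        simp only [List.map_append, List.sum_append, List.map_cons, List.map_map,
          Function.comp_def, List.sum_cons, hanging_cons_left hi h, hanging_cons_right hj h]
        omega

theorem numLeaves_branchMerge {t : RTree} {p q : List ℕ} (hp : t.IsLeaf p) (hq : t.IsLeaf q)
    (hpq : p ≠ q) (labels : List (List ℕ)) :
    (t.branchMerge p q labels).numLeaves + 1 = t.numLeaves := by
  have h0 : t.numLeaves = t.tips := by
    obtain ⟨ts⟩ := t
    rw [numLeaves_node, tips_node]
    rintro rfl
    obtain _ | ⟨i, p⟩ := p
    · exact hp.1 rfl
    · have := hp.2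
      simp [sub_node_cons] at this
  rw [h0, ← sum_branches hp.2 hq.2 hpq, branchMerge, numLeaves_node, tipsList_replant,
    ((mergeBranches_perm _ _).map _).sum_eq]

theorem hanging_nil_ne_nil {ts : List RTree} {i : ℕ} (hi : i < ts.length) (h : ts.length ≠ 1)
    (p q : List ℕ) : hanging (node ts) (i :: p) (i :: q) [] ≠ [] := by
  obtain ⟨k, hk, hki⟩ : ∃ k, k < ts.length ∧ k ≠ i := by
    by_cases h0 : i = 0
    · exact ⟨1, by omega, by omega⟩
    · exact ⟨0, by omega, by omega⟩
  rw [hanging_nil]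
  apply List.ne_nil_of_mem (a := ts.get ⟨k, hk⟩)
  exact List.mem_map_of_mem (by simp [hki])

theorem hanging_path_ne_nil {t : RTree} {p : List ℕ} (hp : (t.sub p).isSome) (ht : t.Reduced)
    {k : ℕ} (hk : k < p.length) : hanging t p p (p.take k) ≠ [] := by
  induction p generalizing t k with
  | nil => simp at hk
  | cons i p ih =>
    obtain ⟨ts⟩ := t
    obtain ⟨u, hu⟩ := Option.isSome_iff_exists.1 hp
    obtain ⟨hi, hu⟩ := lt_of_sub_cons hu
    rw [reduced_node] at ht
    cases k with
    | zero => exact hanging_nil_ne_nil hi ht.1 p p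
    | succ k =>
      rw [List.take_succ_cons, hanging_cons_self hi]
      exact ih (by simp [hu]) (ht.2 _ (List.getElem_mem hi)) (by simpa using hk)

theorem hanging_branches_ne_nil {t : RTree} {p q x : List ℕ} (hp : t.sub p = some (node []))
    (hq : t.sub q = some (node [])) (ht : t.NoDegreeTwo) (hr : x = [] → t.children.length ≠ 1)
    (hx : x ∈ (branches p q).flatten) (hxm : x ≠ meet p q) : hanging t p q x ≠ [] := by
  induction p generalizing t q x with
  | nil =>
    rw [sub_nil, Option.some.injEq] at hp
    subst hp
    cases q with
    | nil => simp [branches, meet] at hx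
    | cons j q => simp [sub_node_cons] at hq
  | cons i p ih =>
    obtain ⟨ts⟩ := t
    obtain ⟨hi, hu⟩ := lt_of_sub_cons hp
    have ht' := (noDegreeTwo_node _).1 ht
    cases q with
    | nil =>
      rw [sub_nil, Option.some.injEq, node.injEq] at hq
      subst hq; simp at hi
    | cons j q =>
      obtain ⟨hj, hv⟩ := lt_of_sub_cons hq
      by_cases h : i = j
      · subst h
        rw [branches_cons_self] at hx
        rw [meet_cons_self] at hxm
        rcases List.mem_cons.1 hx with rfl | hx
        · exact hanging_nil_ne_nil hi (hr rfl) p q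
        · obtain ⟨y, hy, rfl⟩ := List.mem_map.1 hx
          rw [hanging_cons_self hi]
          have hred := ht' _ (List.getElem_mem hi)
          exact ih hu hv (fun z s _ hs => hred z s hs) (fun _ => hred [] _ (sub_nil _)) hy
            (by simpa using hxm)
      · rw [branches_cons_of_ne h] at hx
        rw [meet_cons_of_ne h] at hxm
        rcases List.mem_append.1 hx with hx | hx
        · obtain ⟨k, hk, rfl⟩ := List.mem_map.1 hx
          rw [hanging_cons_left hi h]
          exact hanging_path_ne_nil (by simp [hu]) (ht' _ (List.getElem_mem hi))
            (List.mem_range.1 hk)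
        · rcases List.mem_cons.1 hx with rfl | hx
          · exact absurd rfl hxm
          · obtain ⟨k, hk, rfl⟩ := List.mem_map.1 hx
            rw [hanging_cons_right hj h]
            exact hanging_path_ne_nil (by simp [hv]) (ht' _ (List.getElem_mem hj))
              (List.mem_range.1 hk)

theorem reduced_of_mem_hanging {t : RTree} (ht : t.NoDegreeTwo) {p q x : List ℕ} {s : RTree}
    (hs : s ∈ hanging t p q x) : s.Reduced := by
  unfold hanging at hs
  split at hs
  · simp at hs
  · next u hu =>
    obtain ⟨us⟩ := u
    obtain ⟨k, -, rfl⟩ := List.mem_map.1 hs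
    have hall : ∀ s ∈ us, s.Reduced := by
      obtain ⟨ts⟩ := t
      rw [noDegreeTwo_node] at ht
      cases x with
      | nil =>
        rw [sub_nil, Option.some.injEq, node.injEq] at hu
        exact hu ▸ ht
      | cons i x =>
        obtain ⟨hi, hu⟩ := lt_of_sub_cons hu
        exact ((reduced_node _).1 ((ht _ (List.getElem_mem hi)).sub hu)).2
    exact hall _ (List.get_mem _ _)

theorem NoDegreeTwo.branchMerge {t : RTree} (ht : t.NoDegreeTwo) {p q : List ℕ}
    (hp : t.IsLeaf p) (hq : t.IsLeaf q) (labels : List (List ℕ)) :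
    (t.branchMerge p q labels).NoDegreeTwo := by
  rw [RTree.branchMerge, noDegreeTwo_node]
  apply reduced_replant
  · exact fun x _ s hs => reduced_of_mem_hanging ht hs
  · intro x hx hg
    rw [not_or] at hg
    exact hanging_branches_ne_nil (by simp [hp.2]) (by simp [hq.2]) ht (fun h => absurd h hg.1)
      ((mergeBranches_perm _ _).mem_iff.1 hx) hg.2

end RTree
namespace RTree

theorem Iso.refl (t : RTree) : Iso t t := by
  induction t using induct with
  | h ts ih => exact Iso.node ts ts (Equiv.refl _) fun i => ih _ (List.get_mem _ _)

theorem Iso.symm {t u : RTree} (h : Iso t u) : Iso u t := by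
  induction h with
  | node ts us σ _ ih =>
    refine Iso.node us ts σ.symm fun i => ?_
    have := ih (σ.symm i)
    rwa [Equiv.apply_symm_apply] at this

theorem Iso.trans {t u v : RTree} (h : Iso t u) (h' : Iso u v) : Iso t v := by
  induction h generalizing v with
  | node ts us σ _ ih =>
    cases h' with
    | node _ vs τ h2 => exact Iso.node ts vs (σ.trans τ) fun i => ih i (h2 (σ i))

end RTree

namespace BranchMerging

/-- Rooted plane trees with `n` leaves and no degree-two vertices (except possibly the root). -/
def PlaneTree (n : ℕ) : Type := {t : RTree // t.numLeaves = n ∧ t.NoDegreeTwo}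

instance isoSetoid (n : ℕ) : Setoid (PlaneTree n) where
  r t u := t.1.Iso u.1
  iseqv := ⟨fun t => RTree.Iso.refl t.1, RTree.Iso.symm, RTree.Iso.trans⟩

/-- The set of rooted unlabelled trees with `n` leaves and no degree-two vertices (except possibly
the root): isomorphism classes of rooted trees. -/
def UnlabelledTree (n : ℕ) : Type := Quotient (isoSetoid n)

/-- The subset of binary trees. -/
def binaryTrees (n : ℕ) : Set (UnlabelledTree n) :=
  {x | ∃ t : PlaneTree n, t.1.IsBinary ∧ (Quotient.mk _ t : UnlabelledTree n) = x}

/-- The uniform distribution on a non-empty finite type. -/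
noncomputable def uniform (α : Type) [Finite α] [Nonempty α] : PMF α :=
  letI := Fintype.ofFinite α
  PMF.uniformOfFintype α

/-- Ordered pairs of distinct leaves. -/
def LeafPair (t : RTree) : Type := {z : t.Leaf × t.Leaf // z.1 ≠ z.2}

/-- Allocations of `m` labels onto the leaves that do not belong to a given pair. -/
def Allocation {t : RTree} (z : LeafPair t) (m : ℕ) : Type :=
  Fin m ≃ {r : t.Leaf // r ≠ z.1.1 ∧ r ≠ z.1.2}

instance finite_leafPair (t : RTree) : Finite (LeafPair t) := Subtype.finite

instance finite_allocation {t : RTree} (z : LeafPair t) (m : ℕ) : Finite (Allocation z m) :=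
  inferInstanceAs (Finite (Fin m ≃ _))

theorem nonempty_edge {n : ℕ} (hn : 2 ≤ n) (t : PlaneTree n) : Nonempty t.1.Edge := by
  have h : 0 < Nat.card t.1.Leaf := by
    have := t.2.1
    unfold RTree.numLeaves at this
    omega
  obtain ⟨x, hx⟩ := (Nat.card_pos_iff.1 h).1
  exact ⟨⟨x, hx.1, by simp [hx.2]⟩⟩

theorem nonempty_leafPair {n : ℕ} (hn : 2 ≤ n) (t : PlaneTree (n + 1)) :
    Nonempty (LeafPair t.1) := by
  have h : 1 < Nat.card t.1.Leaf := by
    have := t.2.1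
    unfold RTree.numLeaves at this
    omega
  have := Finite.one_lt_card_iff_nontrivial.1 h
  obtain ⟨x, y, hxy⟩ := exists_pair_ne t.1.Leaf
  exact ⟨⟨(x, y), hxy⟩⟩

theorem nonempty_allocation {n : ℕ} (t : PlaneTree (n + 1)) (z : LeafPair t.1) :
    Nonempty (Allocation z (n - 1)) := by
  classical
  have h : Nat.card {r : t.1.Leaf // r ≠ z.1.1 ∧ r ≠ z.1.2} = n - 1 := by
    have := Fintype.ofFinite t.1.Leaf
    have h1 : Fintype.card t.1.Leaf = n + 1 := by
      rw [← Nat.card_eq_fintype_card]; exact t.2.1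
    rw [Nat.card_eq_fintype_card, Fintype.card_subtype]
    have : (Finset.univ.filter fun r : t.1.Leaf => r ≠ z.1.1 ∧ r ≠ z.1.2) =
        (Finset.univ.erase z.1.2).erase z.1.1 := by
      ext r; simp
    rw [this, Finset.card_erase_of_mem (by simp [z.2]), Finset.card_erase_of_mem (by simp),
      Finset.card_univ, h1]
    omega
  exact ⟨((Finite.equivFin _).trans (finCongr h)).symm⟩

/-- The tree with a leaf inserted at the edge `e`. -/
def insertAt {n : ℕ} (t : PlaneTree n) (e : t.1.Edge) : PlaneTree (n + 1) :=
  ⟨t.1.insertLeaf e.1, by rw [RTree.numLeaves_insertLeaf _ _ e.2, t.2.1],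
    t.2.2.insertLeaf e.2⟩

/-- The tree after branch merging, where `z = (Σ₁, Σ̃₁)` and `ℓ` allocates the labels
`2, …, n` (here numbered from `0`) to the other leaves. -/
def mergeAt {n : ℕ} (t : PlaneTree (n + 1)) (z : LeafPair t.1) (ℓ : Allocation z (n - 1)) :
    PlaneTree n :=
  ⟨t.1.branchMerge z.1.1.1 z.1.2.1 (List.ofFn fun k => (ℓ.toFun k).1.1), by
    have := RTree.numLeaves_branchMerge z.1.1.2 z.1.2.2 (fun h => z.2 (Subtype.ext h))
      (List.ofFn fun k => (ℓ.toFun k).1.1)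
    have h := t.2.1
    omega, t.2.2.branchMerge z.1.1.2 z.1.2.2 _⟩

/-- One step of the discrete branch merging chain, for a plane tree: choose an edge uniformly at
random and insert a leaf there, sample an ordered pair of distinct leaves uniformly at random,
allocate the labels `2, …, n` uniformly at random to the other leaves, and merge the branches. -/
noncomputable def planeStep {n : ℕ} (hn : 2 ≤ n) (t : PlaneTree n) : PMF (PlaneTree n) :=
  haveI := nonempty_edge hn t
  (uniform t.1.Edge).bind fun e =>
    haveI := nonempty_leafPair hn (insertAt t e)
    (uniform (LeafPair (insertAt t e).1)).bind fun z =>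
      haveI := nonempty_allocation (insertAt t e) z
      (uniform (Allocation z (n - 1))).map fun ℓ => mergeAt (insertAt t e) z ℓ

/-- The transition kernel of the discrete branch merging chain on unlabelled trees: a step is
performed in a plane representative, and the plane structure of the result is forgotten. (The
law of the result does not depend on the representative, as no part of the step refers to the
order of the children of a vertex.) -/
noncomputable def step {n : ℕ} (hn : 2 ≤ n) (x : UnlabelledTree n) : PMF (UnlabelledTree n) :=
  (planeStep hn (Quotient.out x)).map fun t => Quotient.mk _ t

section Chains

variable {S : Type}

/-- The law at time `k` of the Markov chain with transition kernel `P` and initial law `μ`. -/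
noncomputable def law (P : S → PMF S) (μ : PMF S) (k : ℕ) : PMF S :=
  (fun ν : PMF S => ν.bind P)^[k] μ

/-- `y` is accessible from `x`. -/
def Accessible (P : S → PMF S) (x y : S) : Prop := ∃ k, law P (PMF.pure x) k y ≠ 0

/-- A communicating class: an equivalence class of the relation of mutual accessibility. -/
def IsCommunicatingClass (P : S → PMF S) (C : Set S) : Prop :=
  ∃ x, C = {y | Accessible P x y ∧ Accessible P y x}

/-- A closed set of states, which the chain cannot leave. -/
def IsClosedSet (P : S → PMF S) (C : Set S) : Prop :=
  ∀ x ∈ C, ∀ y, Accessible P x y → y ∈ C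

/-- A stationary distribution. -/
def IsStationary (P : S → PMF S) (π : PMF S) : Prop := π.bind P = π

end Chains

end BranchMerging

namespace RTree

/-! ### Isomorphism and replacement of subtrees -/

-- The quantity that drives the proof is the number of vertices, `size`. Inserting a leaf adds two
-- vertices. Branch merging removes `Σ̃`, and also `Ω` when `Ω ≠ ρ`, so it removes one vertex if `Ω
-- = ρ` and two otherwise (`size_branchMerge`). Hence a step never decreases `size`, and it
-- increases it by one exactly when the two chosen leaves lie above different children of the root.
-- A tree with `n` leaves and no degree-two vertices off the root has at most `2 * n` vertices, with
-- equality exactly for binary trees (`NoDegreeTwo.isBinary`, `IsBinary.size_eq`). So the binary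
-- trees are closed.
--
-- They are accessible from everywhere (`exists_size_lt`). If the root has at least two children,
-- some step gains a vertex. If it has only one child and the tree is not binary, then some vertex
-- `v` has at least three children. Merging with `Ω = v`, and with the first label on a third
-- subtree at `v`, puts `v` first on the new spine. Its subtrees then land on the root, which now
-- has at least two children, and the next step can gain a vertex.
--
-- Binary trees communicate through cherry moves. Inserting a leaf at a leaf edge creates a cherry,
-- and merging the two leaves of any cherry collapses it to a leaf, whatever the labels are
-- (`branchMerge_cherry`). Induction on the number of leaves connects all binary trees by such moves
-- (`IsBinary.reflTransGen_cherryMove`). Collapsing the cherry just created gives every state a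
-- loop.
--
-- The rest is Doeblin's argument: a finite chain in which some state with a loop is accessible from
-- everywhere contracts the `ℓ¹` distance geometrically along blocks of fixed length
-- (`exists_stationary_tendsto`). Only supports of transition laws and isomorphism invariants enter,
-- so the choice of plane representatives in `step` does no harm.

theorem Iso.cons {a b : RTree} {ts us : List RTree} (h : Iso a b) (h' : Iso (.node ts) (.node us)) :
    Iso (.node (a :: ts)) (.node (b :: us)) := by
  cases h' with
  | node _ _ σ hσ =>
    refine Iso.node _ _ ((finSuccEquiv ts.length).trans
      ((Equiv.optionCongr σ).trans (finSuccEquiv us.length).symm)) fun i => ?_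
    induction i using Fin.cases with
    | zero => simpa using h
    | succ i => simpa using hσ i

theorem Iso.of_perm {ts us : List RTree} (h : ts.Perm us) : Iso (.node ts) (.node us) := by
  induction h with
  | nil => exact Iso.refl _
  | cons a _ ih => exact (Iso.refl a).cons ih
  | swap a b l =>
    refine Iso.node _ _ (Equiv.swap ⟨0, by simp⟩ ⟨1, by simp⟩) fun i => ?_
    obtain ⟨i, hi⟩ := i
    match i with
    | 0 => simpa using Iso.refl _
    | 1 => simpa using Iso.refl _
    | i + 2 =>
      rw [Equiv.swap_apply_of_ne_of_ne (by simp) (by simp)]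
      exact Iso.refl _
  | trans _ _ ih ih' => exact ih.trans ih'

/-- Replace the subtree above the vertex with the given address. -/
def graft : RTree → List ℕ → RTree → RTree
  | _, [], r => r
  | t, i :: x, r => node (t.children.modify i fun s => graft s x r)

theorem graft_nil (t r : RTree) : t.graft [] r = r := by simp [graft]

theorem graft_node_cons (ts : List RTree) (i : ℕ) (x : List ℕ) (r : RTree) :
    (node ts).graft (i :: x) r = node (ts.modify i fun s => s.graft x r) := by
  simp [graft, children]

/-- An isomorphism carries vertices to vertices. The equality of lengths is there so that non-root
vertices go to non-root vertices, and the last clause says that the isomorphism survives any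
replacement of the two matched subtrees. -/
theorem Iso.exists_vertex {t u : RTree} (h : Iso t u) {x : List ℕ} {s : RTree}
    (hx : t.sub x = some s) : ∃ y s', u.sub y = some s' ∧ y.length = x.length ∧ Iso s s' ∧
      ∀ r, Iso (t.graft x r) (u.graft y r) := by
  induction h generalizing x s with
  | node ts us σ h ih =>
    cases x with
    | nil =>
      rw [sub_nil, Option.some.injEq] at hx
      subst hx
      exact ⟨[], _, sub_nil _, rfl, Iso.node ts us σ h, fun r => by
        rw [graft_nil, graft_nil]; exact Iso.refl r⟩
    | cons i x =>
      obtain ⟨hi, hs⟩ := lt_of_sub_cons hx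
      obtain ⟨y, s', hy, hl, hss, hr⟩ := ih ⟨i, hi⟩ hs
      refine ⟨(σ ⟨i, hi⟩ : ℕ) :: y, s', ?_, by simp [hl], hss, fun r => ?_⟩
      · rw [sub_cons_of_lt (σ ⟨i, hi⟩).2]; exact hy
      · rw [graft_node_cons, graft_node_cons]
        refine Iso.node _ _ ((finCongr (by simp)).trans (σ.trans (finCongr (by simp)))) ?_
        rintro ⟨j, hj⟩
        have hj' : j < ts.length := by simpa using hj
        by_cases hij : i = j
        · subst hij
          simpa using hr r
        · have hne : (σ ⟨i, hi⟩ : ℕ) ≠ (σ ⟨j, hj'⟩ : ℕ) := fun h0 =>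
            hij (by simpa using σ.injective (Fin.ext h0))
          simpa [List.getElem_modify, hij, hne] using h ⟨j, hj'⟩

theorem sub_graft {t : RTree} {x : List ℕ} (h : (t.sub x).isSome) (r : RTree) :
    (t.graft x r).sub x = some r := by
  induction x generalizing t with
  | nil => simp [graft_nil, sub_nil]
  | cons i x ih =>
    obtain ⟨ts⟩ := t
    obtain ⟨u, hu⟩ := Option.isSome_iff_exists.1 h
    obtain ⟨hi, hu⟩ := lt_of_sub_cons hu
    rw [graft_node_cons, sub_cons_of_lt (by simpa using hi)]
    simpa using ih (t := ts[i]) (by simp [hu])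

theorem graft_graft (t : RTree) (x : List ℕ) (r s : RTree) :
    (t.graft x r).graft x s = t.graft x s := by
  induction x generalizing t with
  | nil => simp [graft_nil]
  | cons i x ih =>
    obtain ⟨ts⟩ := t
    simp [graft_node_cons, List.modify_modify_eq, Function.comp_def, ih]

theorem graft_self {t s : RTree} {x : List ℕ} (h : t.sub x = some s) : t.graft x s = t := by
  induction x generalizing t with
  | nil => simpa [graft_nil, sub_nil] using h.symm
  | cons i x ih =>
    obtain ⟨ts⟩ := t
    obtain ⟨hi, hu⟩ := lt_of_sub_cons h
    rw [graft_node_cons, node.injEq]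
    apply List.ext_getElem (by simp)
    intro j h1 h2
    rw [List.getElem_modify]
    split
    · next hij => subst hij; exact ih hu
    · rfl

/-- Distinct leaf addresses are incomparable as words, so replacements at them do not interact. -/
theorem graft_comm {t : RTree} {x y : List ℕ} (hx : t.sub x = some (node []))
    (hy : t.sub y = some (node [])) (hxy : x ≠ y) (r s : RTree) :
    (t.graft x r).sub y = some (node []) ∧
      (t.graft x r).graft y s = (t.graft y s).graft x r := by
  induction x generalizing t y with
  | nil =>
    rw [sub_nil, Option.some.injEq] at hx
    subst hx
    cases y with
    | nil => exact absurd rfl hxy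
    | cons j y => simp [sub_node_cons] at hy
  | cons i x ih =>
    obtain ⟨ts⟩ := t
    obtain ⟨hi, hu⟩ := lt_of_sub_cons hx
    cases y with
    | nil =>
      rw [sub_nil, Option.some.injEq, node.injEq] at hy
      subst hy; simp at hi
    | cons j y =>
      obtain ⟨hj, hv⟩ := lt_of_sub_cons hy
      simp only [graft_node_cons]
      rw [sub_cons_of_lt (by simpa using hj), node.injEq]
      by_cases h : i = j
      · subst h
        obtain ⟨h1, h2⟩ := ih hu hv (by simpa using hxy)
        refine ⟨by simpa using h1, ?_⟩
        apply List.ext_getElem (by simp)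
        intro k _ _
        simp only [List.getElem_modify]
        split
        · next hk => subst hk; exact h2
        · rfl
      · refine ⟨by simpa [List.getElem_modify, h] using hv, ?_⟩
        apply List.ext_getElem (by simp)
        intro k _ _
        simp only [List.getElem_modify]
        split_ifs with h1 h2 <;> simp_all

-- Splitting leaves and cherry moves

/-- The tree consisting of a vertex with two leaves. -/
abbrev cherry : RTree := node [node [], node []]

theorem insertLeaf_eq_graft {t : RTree} {x : List ℕ} (h : t.sub x = some (node [])) :
    t.insertLeaf x = t.graft x cherry := by
  induction x generalizing t with
  | nil =>
    rw [sub_nil, Option.some.injEq] at h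
    subst h; simp [insertLeaf, graft_nil]
  | cons i x ih =>
    obtain ⟨ts⟩ := t
    obtain ⟨hi, hu⟩ := lt_of_sub_cons h
    rw [insertLeaf, graft_node_cons, children, node.injEq]
    apply List.ext_getElem (by simp)
    intro k _ _
    simp only [List.getElem_modify]
    split
    · next hk => subst hk; exact ih hu
    · rfl

theorem Iso.eq_leaf {t : RTree} (h : Iso (.node []) t) : t = .node [] := by
  cases h with
  | node _ us σ _ =>
    have := Fintype.card_congr σ
    simp only [Fintype.card_fin, List.length_nil] at this
    rw [List.length_eq_zero_iff.1 this.symm]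

theorem Iso.length_children {t u : RTree} (h : Iso t u) :
    t.children.length = u.children.length := by
  cases h with
  | node ts us σ _ => simpa [children] using Fintype.card_congr σ

theorem Iso.eq_cherry {t : RTree} (h : Iso cherry t) : t = cherry := by
  have hl := h.length_children
  cases h.symm with
  | node us _ σ hσ =>
    simp only [children, List.length_cons, List.length_nil, Nat.reduceAdd] at hl
    rw [node.injEq]
    apply List.ext_getElem (by simpa using hl.symm)
    intro i h1 h2
    have := hσ ⟨i, h1⟩
    have h3 : ∀ j : Fin [RTree.node [], RTree.node []].length,
        [RTree.node [], RTree.node []].get j = RTree.node [] := by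
      intro j
      exact List.eq_of_mem_replicate (n := 2) (List.get_mem [RTree.node [], RTree.node []] j)
    rw [h3] at this
    rw [show us[i] = RTree.node [] from this.symm.eq_leaf]
    exact (h3 ⟨i, h2⟩).symm

/-- Up to isomorphism, `w` arises from `t` by replacing a leaf by a cherry. -/
def Split (t w : RTree) : Prop := ∃ x, t.IsLeaf x ∧ Iso (t.graft x cherry) w

theorem Split.of_iso_left {t u w : RTree} (h : Iso t u) (hs : Split t w) : Split u w := by
  obtain ⟨x, ⟨hx0, hx⟩, hw⟩ := hs
  obtain ⟨y, s, hy, hl, hss, hr⟩ := h.exists_vertex hx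
  obtain rfl := hss.eq_leaf
  exact ⟨y, ⟨by rintro rfl; exact hx0 (List.length_eq_zero_iff.1 hl.symm), hy⟩,
    (hr _).symm.trans hw⟩

theorem Split.of_iso_right {t w v : RTree} (hs : Split t w) (h : Iso w v) : Split t v := by
  obtain ⟨x, hx, hw⟩ := hs
  exact ⟨x, hx, hw.trans h⟩

/-- Reverses a split inside the given representative `w`: this locates the cherry that a step must
collapse. -/
theorem Split.exists_cherry {t w : RTree} (hs : Split t w) :
    ∃ c, c ≠ [] ∧ w.sub c = some cherry ∧ Iso (w.graft c (node [])) t := by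
  obtain ⟨x, ⟨hx0, hx⟩, hw⟩ := hs
  obtain ⟨c, s, hc, hl, hss, hr⟩ := hw.exists_vertex (sub_graft (by simp [hx]) cherry)
  obtain rfl := hss.eq_cherry
  refine ⟨c, by rintro rfl; exact hx0 (List.length_eq_zero_iff.1 hl.symm), hc, (hr _).symm.trans ?_⟩
  rw [graft_graft, graft_self hx]
  exact Iso.refl _

/-- Up to isomorphism, `u` arises from `t` by replacing a leaf by a cherry and then a cherry by
a leaf. -/
def CherryMove (t u : RTree) : Prop := ∃ w, Split t w ∧ Split u w

/-- Two splits of the same tree have a common further split: if different leaves were split, perform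
both splits. If the same leaf was split, `u` and `v` are isomorphic, and splitting a leaf of the new
cherry serves for both. -/
theorem Split.cherryMove {t u v : RTree} (hu : Split t u) (hv : Split t v) : CherryMove u v := by
  obtain ⟨x, hx, hu⟩ := hu
  obtain ⟨y, hy, hv⟩ := hv
  by_cases h : x = y
  · subst h
    have h1 : (t.graft x cherry).sub (x ++ [0]) = some (node []) := by
      have h2 : ∀ (x : List ℕ) (t : RTree), t.sub x = some cherry →
          t.sub (x ++ [0]) = some (node []) := by
        intro x
        induction x with
        | nil =>
          intro t ht
          rw [sub_nil, Option.some.injEq] at ht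
          subst ht; rfl
        | cons i x ih =>
          rintro ⟨ts⟩ ht
          obtain ⟨hi, ht⟩ := lt_of_sub_cons ht
          rw [List.cons_append, sub_cons_of_lt hi]
          exact ih _ ht
      exact h2 x _ (sub_graft (by simp [hx.2]) _)
    have h3 : Split (t.graft x cherry) ((t.graft x cherry).graft (x ++ [0]) cherry) :=
      ⟨x ++ [0], ⟨by simp, h1⟩, Iso.refl _⟩
    exact ⟨_, h3.of_iso_left hu, h3.of_iso_left hv⟩
  · obtain ⟨h1, h2⟩ := graft_comm hx.2 hy.2 h cherry cherry
    obtain ⟨h3, -⟩ := graft_comm hy.2 hx.2 (Ne.symm h) cherry cherry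
    refine ⟨(t.graft x cherry).graft y cherry, ?_, ?_⟩
    · exact Split.of_iso_left hu ⟨y, ⟨hy.1, h1⟩, Iso.refl _⟩
    · exact Split.of_iso_left hv ⟨x, ⟨hx.1, h3⟩, by rw [h2]; exact Iso.refl _⟩

/-- Lifts a chain of cherry moves to trees with one more leaf. The common split `w` of two
consecutive trees in the chain is itself a split of each of them, so `w` serves as the stepping
stone one level up. -/
theorem Split.reflTransGen_cherryMove {t t' u u' : RTree}
    (h : Relation.ReflTransGen CherryMove t t') (hu : Split t u) (hu' : Split t' u') :
    Relation.ReflTransGen CherryMove u u' := by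
  induction h generalizing u' with
  | refl => exact .single (hu.cherryMove hu')
  | tail _ h ih =>
    obtain ⟨w, h1, h2⟩ := h
    exact (ih h1).tail (h2.cherryMove hu')

/-! ### Binary trees -/

/-- Every vertex has no or two children. -/
inductive Full : RTree → Prop
  | leaf : Full (node [])
  | pair (a b : RTree) : Full a → Full b → Full (node [a, b])

theorem full_of_forall {t : RTree}
    (h : ∀ x s, t.sub x = some s → s.children.length = 0 ∨ s.children.length = 2) : Full t := by
  induction t using induct with
  | h ts ih =>
    have h0 : ∀ s ∈ ts, Full s := by
      intro s hs
      refine ih s hs fun x u hu => ?_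
      obtain ⟨i, hi, rfl⟩ := List.getElem_of_mem hs
      exact h (i :: x) u (by rw [sub_cons_of_lt hi, hu])
    rcases h [] _ (sub_nil _) with h1 | h1
    · obtain rfl := List.length_eq_zero_iff.1 h1
      exact .leaf
    · obtain ⟨a, b, rfl⟩ := List.length_eq_two.1 h1
      exact .pair a b (h0 a (by simp)) (h0 b (by simp))

theorem Full.length_children {t : RTree} (h : Full t) {x : List ℕ} {s : RTree}
    (hx : t.sub x = some s) : s.children.length = 0 ∨ s.children.length = 2 := by
  induction h generalizing x s with
  | leaf =>
    cases x with
    | nil => rw [sub_nil, Option.some.injEq] at hx; subst hx; exact Or.inl rfl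
    | cons i x => simp [sub_node_cons] at hx
  | pair a b ha hb iha ihb =>
    cases x with
    | nil => rw [sub_nil, Option.some.injEq] at hx; subst hx; exact Or.inr rfl
    | cons i x =>
      obtain ⟨hi, hx⟩ := lt_of_sub_cons hx
      match i, hi, hx with
      | 0, _, hx => exact iha hx
      | 1, _, hx => exact ihb hx

theorem isBinary_iff {t : RTree} : t.IsBinary ↔ ∃ a, t = node [a] ∧ Full a := by
  constructor
  · rintro ⟨h1, h2⟩
    obtain ⟨ts⟩ := t
    obtain ⟨a, rfl⟩ := List.length_eq_one_iff.1 h1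
    exact ⟨a, rfl, full_of_forall fun x s hx => h2 (0 :: x) s (by simp) hx⟩
  · rintro ⟨a, rfl, ha⟩
    refine ⟨rfl, fun x s hx0 hx => ?_⟩
    cases x with
    | nil => exact absurd rfl hx0
    | cons i x =>
      obtain ⟨hi, hx⟩ := lt_of_sub_cons hx
      obtain rfl : i = 0 := by simpa using hi
      exact ha.length_children hx

theorem IsBinary.of_iso {t u : RTree} (ht : t.IsBinary) (h : Iso t u) : u.IsBinary := by
  refine ⟨h.length_children ▸ ht.1, fun x s hx0 hx => ?_⟩
  obtain ⟨y, s', hy, hl, hss, -⟩ := h.symm.exists_vertex hx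
  rw [hss.length_children]
  exact ht.2 y s' (by rintro rfl; exact hx0 (List.length_eq_zero_iff.1 hl.symm)) hy

/-- Descending through children that are not leaves ends at a vertex whose two children are both
leaves, that is, at a cherry, which can be collapsed. -/
theorem Full.exists_graft {t : RTree} (h : Full t) (h0 : t ≠ node []) :
    ∃ s x, Full s ∧ s.sub x = some (node []) ∧ s.graft x cherry = t := by
  induction h with
  | leaf => exact absurd rfl h0
  | pair a b ha hb iha ihb =>
    by_cases ha0 : a = RTree.node []
    · by_cases hb0 : b = RTree.node []
      · subst ha0 hb0
        exact ⟨RTree.node [], [], .leaf, sub_nil _, graft_nil _ _⟩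
      · obtain ⟨s, x, hs, hx, rfl⟩ := ihb hb0
        exact ⟨RTree.node [a, s], 1 :: x, .pair a s ha hs, hx, by simp [graft_node_cons]⟩
    · obtain ⟨s, x, hs, hx, rfl⟩ := iha ha0
      exact ⟨RTree.node [s, b], 0 :: x, .pair s b hs hb, hx, by simp [graft_node_cons]⟩

theorem numLeaves_graft_cherry {t : RTree} {x : List ℕ} (h : t.IsLeaf x) :
    (t.graft x cherry).numLeaves = t.numLeaves + 1 := by
  rw [← insertLeaf_eq_graft h.2, numLeaves_insertLeaf _ _ ⟨h.1, by simp [h.2]⟩]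

theorem Full.tips_pos {t : RTree} (h : Full t) : 0 < t.tips := by
  induction h with
  | leaf => simp [tips_leaf]
  | pair a b _ _ iha _ => rw [tips_node (by simp)]; simp only [tipsList_cons]; omega

theorem numLeaves_singleton (a : RTree) : (node [a]).numLeaves = a.tips := by
  simp [numLeaves_node, tipsList]

/-- All binary trees with the same number of leaves are connected by cherry moves. -/
theorem IsBinary.reflTransGen_cherryMove {t u : RTree} (ht : t.IsBinary) (hu : u.IsBinary)
    (h : t.numLeaves = u.numLeaves) : Relation.ReflTransGen CherryMove t u := by
  obtain ⟨n, hn⟩ : ∃ n, n = t.numLeaves := ⟨_, rfl⟩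
  have key : ∀ t : RTree, t.IsBinary →
      (t = node [node []] ∧ t.numLeaves = 1) ∨
        ∃ s, s.IsBinary ∧ Split s t ∧ s.numLeaves + 1 = t.numLeaves ∧ 0 < s.numLeaves := by
    intro t ht
    obtain ⟨a, rfl, ha⟩ := isBinary_iff.1 ht
    by_cases h0 : a = node []
    · subst h0
      exact Or.inl ⟨rfl, by rw [numLeaves_singleton, tips_leaf]⟩
    · obtain ⟨s, x, hs, hx, rfl⟩ := ha.exists_graft h0
      have hl : (node [s]).IsLeaf (0 :: x) := ⟨by simp, hx⟩
      have he : (node [s]).graft (0 :: x) cherry = node [s.graft x cherry] := by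
        simp [graft_node_cons]
      refine Or.inr ⟨node [s], isBinary_iff.2 ⟨s, rfl, hs⟩, ⟨0 :: x, hl, ?_⟩, ?_, ?_⟩
      · rw [he]; exact Iso.refl _
      · rw [← numLeaves_graft_cherry hl, he]
      · rw [numLeaves_singleton]; exact hs.tips_pos
  induction n generalizing t u with
  | zero =>
    rcases key t ht with ⟨-, h1⟩ | ⟨s, -, -, h1, h2⟩ <;> omega
  | succ n ih =>
    rcases key t ht with ⟨h0, h1⟩ | ⟨s, hs, hst, h1, h2⟩
    · rcases key u hu with ⟨h0', h1'⟩ | ⟨s', hs', hst', h1', h2'⟩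
      · rw [h0, h0']
      · omega
    · rcases key u hu with ⟨h0', h1'⟩ | ⟨s', hs', hst', h1', h2'⟩
      · omega
      · exact Split.reflTransGen_cherryMove (ih hs hs' (by omega) (by omega)) hst hst'

end RTree

namespace RTree

/-! ### Counting vertices -/

mutual
/-- The number of vertices. -/
def size : RTree → ℕ
  | node ts => sizeList ts + 1

/-- The total number of vertices of a list of trees. -/
def sizeList : List RTree → ℕ
  | [] => 0
  | t :: ts => size t + sizeList ts
end

theorem sizeList_append (ts us : List RTree) :
    sizeList (ts ++ us) = sizeList ts + sizeList us := by
  induction ts with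
  | nil => simp [sizeList]
  | cons t ts ih => simp only [List.cons_append, sizeList, ih]; omega

theorem sizeList_perm {ts us : List RTree} (h : ts.Perm us) : sizeList ts = sizeList us := by
  induction h with
  | nil => rfl
  | cons a _ ih => simp only [sizeList, ih]
  | swap a b l => simp only [sizeList]; omega
  | trans _ _ ih ih' => exact ih.trans ih'

theorem perm_hanging_self {ts : List RTree} {i : ℕ} (hi : i < ts.length) (p q : List ℕ) :
    ts.Perm (ts[i] :: hanging (node ts) (i :: p) (i :: q) []) := by
  have h : (List.finRange ts.length).Perm ((⟨i, hi⟩ : Fin ts.length) ::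
      (List.finRange ts.length).filter fun k : Fin _ => (k : ℕ) ≠ i ∧ (k : ℕ) ≠ i) := by
    rw [List.perm_ext_iff_of_nodup (List.nodup_finRange _)]
    · intro a
      simp [Fin.ext_iff, em]
    · exact List.nodup_cons.2 ⟨by simp, (List.nodup_finRange _).filter _⟩
  have := h.map ts.get
  rwa [List.map_get_finRange, List.map_cons, ← hanging_nil ts i i p q] at this

theorem perm_hanging_of_ne {ts : List RTree} {i j : ℕ} (hi : i < ts.length) (hj : j < ts.length)
    (hij : i ≠ j) (p q : List ℕ) :
    ts.Perm (ts[i] :: ts[j] :: hanging (node ts) (i :: p) (j :: q) []) := by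
  have h : (List.finRange ts.length).Perm ((⟨i, hi⟩ : Fin ts.length) :: (⟨j, hj⟩ : Fin ts.length) ::
      (List.finRange ts.length).filter fun k : Fin _ => (k : ℕ) ≠ i ∧ (k : ℕ) ≠ j) := by
    rw [List.perm_ext_iff_of_nodup (List.nodup_finRange _)]
    · intro a
      simp only [List.mem_finRange, List.mem_cons, List.mem_filter, Fin.ext_iff, true_iff,
        decide_eq_true_eq, true_and]
      tauto
    · exact List.nodup_cons.2 ⟨by simp [hij],
        List.nodup_cons.2 ⟨by simp, (List.nodup_finRange _).filter _⟩⟩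
  have := h.map ts.get
  rwa [List.map_get_finRange, List.map_cons, List.map_cons, ← hanging_nil ts i j p q] at this

theorem size_modify (f : RTree → RTree) (ts : List RTree) (i : ℕ) (hi : i < ts.length) {m : ℕ}
    (hf : (f ts[i]).size = ts[i].size + m) : sizeList (ts.modify i f) = sizeList ts + m := by
  induction ts generalizing i with
  | nil => simp at hi
  | cons t ts ih =>
    cases i with
    | zero => simp only [List.modify_zero_cons, sizeList]; simp at hf; omega
    | succ i =>
      simp only [List.modify_succ_cons, sizeList]
      rw [ih i (by simpa using hi) (by simpa using hf)]; omega

theorem size_insertLeaf (t : RTree) (e : List ℕ) (he : (t.sub e).isSome) :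
    (t.insertLeaf e).size = t.size + 2 := by
  induction e generalizing t with
  | nil => simp [insertLeaf, size, sizeList]
  | cons i e ih =>
    obtain ⟨ts⟩ := t
    obtain ⟨u, hu⟩ := Option.isSome_iff_exists.1 he
    obtain ⟨hi, hu⟩ := lt_of_sub_cons hu
    rw [insertLeaf, children, size, size, size_modify _ ts i hi (ih _ (by simp [hu]))]

theorem size_path {t : RTree} {p : List ℕ} (hp : t.sub p = some (node [])) :
    ((List.range p.length).map fun k => sizeList (hanging t p p (p.take k)) + 1).sum + 1 =
      t.size := by
  induction p generalizing t with
  | nil =>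
    rw [sub_nil, Option.some.injEq] at hp
    simp [hp, size, sizeList]
  | cons i p ih =>
    obtain ⟨ts⟩ := t
    obtain ⟨hi, hu⟩ := lt_of_sub_cons hp
    have := ih hu
    rw [size, sizeList_perm (perm_hanging_self hi p p), sizeList, ← this]
    simp only [List.length_cons, List.range_succ_eq_map, List.map_cons, List.map_map,
      Function.comp_def, List.take_succ_cons, List.take_zero, List.sum_cons,
      hanging_cons_self hi]
    omega

/-- The branches list every vertex of the reduced tree once except the two leaves `p` and `q`, which
account for the `2`. The count for `meet p q` alone is what makes the induction for the last count
possible. -/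
theorem size_branches {t : RTree} {p q : List ℕ} (hp : t.sub p = some (node []))
    (hq : t.sub q = some (node [])) (hpq : p ≠ q) :
    ((branches p q).flatten.map fun x => sizeList (hanging t p q x) + 1).sum + 2 = t.size ∧
      (branches p q).flatten.countP (fun x => x = meet p q) = 1 ∧
      (branches p q).flatten.countP (fun x => x = [] ∨ x = meet p q) =
        if meet p q = [] then 1 else 2 := by
  induction p generalizing t q with
  | nil =>
    rw [sub_nil, Option.some.injEq] at hp
    subst hp
    cases q with
    | nil => exact absurd rfl hpq
    | cons j q => simp [sub_node_cons] at hq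
  | cons i p ih =>
    obtain ⟨ts⟩ := t
    obtain ⟨hi, hu⟩ := lt_of_sub_cons hp
    cases q with
    | nil =>
      rw [sub_nil, Option.some.injEq, node.injEq] at hq
      subst hq; simp at hi
    | cons j q =>
      obtain ⟨hj, hv⟩ := lt_of_sub_cons hq
      by_cases h : i = j
      · subst h
        -- The root of the subtree `ts[i]` is no longer glued in the larger tree, so its count of
        -- glued vertices does not carry over; the count of branch points does.
        obtain ⟨h1, h2, -⟩ := ih hu hv (by simpa using hpq)
        rw [size, sizeList_perm (perm_hanging_self hi p q), sizeList, ← h1, branches_cons_self,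
          meet_cons_self]
        refine ⟨?_, ?_, ?_⟩
        · simp only [List.map_cons, List.map_map, Function.comp_def, List.sum_cons,
            hanging_cons_self hi]
          omega
        · simpa [List.countP_cons, List.countP_map, Function.comp_def] using h2
        · simpa [List.countP_cons, List.countP_map, Function.comp_def] using h2
      · have h1 := size_path hu
        have h2 := size_path hv
        rw [size, sizeList_perm (perm_hanging_of_ne hi hj h p q), sizeList, sizeList, ← h1, ← h2,
          branches_cons_of_ne h, meet_cons_of_ne h]
        refine ⟨?_, ?_, ?_⟩
        · simp only [List.map_append, List.sum_append, List.map_cons, List.map_map,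
            Function.comp_def, List.sum_cons, hanging_cons_left hi h, hanging_cons_right hj h]
          omega
        · simp [List.countP_map, Function.comp_def]
        · simp [List.countP_map, Function.comp_def]

theorem sizeList_replant (S : List ℕ → List RTree) (glue : List ℕ → Prop) [DecidablePred glue]
    (xs : List (List ℕ)) :
    sizeList (replant S glue xs) + xs.countP (fun x => glue x) =
      (xs.map fun x => sizeList (S x) + 1).sum + 1 := by
  induction xs with
  | nil => simp [replant, sizeList, size]
  | cons x xs ih =>
    unfold replant
    split
    · next h =>
      simp only [sizeList_append, List.map_cons, List.sum_cons, List.countP_cons, h]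
      simp only [decide_true, if_true]; omega
    · next h =>
      simp only [sizeList_append, sizeList, size, List.map_cons, List.sum_cons, List.countP_cons, h]
      simp only [decide_false, Bool.false_eq_true, if_false]; omega

/-- Each glued vertex of the spine disappears, while a new root and the leaf at the end are added,
replacing `p` and `q` in the balance. The loss is therefore the number of distinct vertices among
`ρ` and `Ω`. -/
theorem size_branchMerge {t : RTree} {p q : List ℕ} (hp : t.IsLeaf p) (hq : t.IsLeaf q)
    (hpq : p ≠ q) (labels : List (List ℕ)) :
    (t.branchMerge p q labels).size + (if meet p q = [] then 1 else 2) = t.size := by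
  obtain ⟨h1, -, h2⟩ := size_branches hp.2 hq.2 hpq
  have h3 := mergeBranches_perm (branches p q) (labels.map (proj p q))
  have h4 := sizeList_replant (hanging t p q) (fun x => x = [] ∨ x = meet p q)
    (mergeBranches (branches p q) (labels.map (proj p q)))
  rw [h3.countP_eq, (h3.map _).sum_eq, h2] at h4
  rw [branchMerge, size]
  omega

-- Binary trees as the trees with the largest number of vertices

theorem Reduced.size_le {t : RTree} (h : t.Reduced) :
    t.size + 1 ≤ 2 * t.tips ∧ (t.size + 1 = 2 * t.tips → Full t) := by
  induction t using induct with
  | h ts ih =>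
    obtain ⟨h1, h2⟩ := (reduced_node ts).1 h
    have key : ∀ us : List RTree, (∀ s ∈ us, s ∈ ts) →
        sizeList us + us.length ≤ 2 * tipsList us ∧
          (sizeList us + us.length = 2 * tipsList us → ∀ s ∈ us, Full s) := by
      intro us hus
      induction us with
      | nil => simp [sizeList, tipsList]
      | cons u us ih' =>
        obtain ⟨h3, h4⟩ := ih' fun s hs => hus s (List.mem_cons_of_mem _ hs)
        obtain ⟨h5, h6⟩ := ih u (hus u (by simp)) (h2 u (hus u (by simp)))
        rw [tipsList_cons, sizeList, List.length_cons]
        refine ⟨by omega, fun h7 s hs => ?_⟩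
        rcases List.mem_cons.1 hs with rfl | hs
        · exact h6 (by omega)
        · exact h4 (by omega) s hs
    obtain ⟨h3, h4⟩ := key ts fun _ h => h
    rcases ts with _ | ⟨a, _ | ⟨b, us⟩⟩
    · exact ⟨by simp [size, sizeList, tips_leaf], fun _ => .leaf⟩
    · simp at h1
    · rw [tips_node (by simp), size]
      simp only [List.length_cons] at h3 h4
      refine ⟨by omega, fun h5 => ?_⟩
      -- The bound for the children has slack equal to the number of children minus two, so equality
      -- forces exactly two.
      obtain rfl : us = [] := List.length_eq_zero_iff.1 (by omega)
      exact .pair a b (h4 (by simp at *; omega) a (by simp)) (h4 (by simp at *; omega) b (by simp))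

theorem NoDegreeTwo.size_add_length_le {t : RTree} (h : t.NoDegreeTwo) :
    t.size + t.children.length ≤ 2 * t.numLeaves + 1 := by
  obtain ⟨ts⟩ := t
  rw [noDegreeTwo_node] at h
  rw [numLeaves_node, children, size]
  induction ts with
  | nil => simp [sizeList]
  | cons u us ih =>
    have h1 := (h u (by simp)).size_le.1
    have h2 := ih fun s hs => h s (List.mem_cons_of_mem _ hs)
    rw [tipsList_cons, sizeList, List.length_cons]
    omega

theorem Full.size_eq {t : RTree} (h : Full t) : t.size + 1 = 2 * t.tips := by
  induction h with
  | leaf => simp [size, sizeList, tips_leaf]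
  | pair a b _ _ iha ihb =>
    rw [tips_node (by simp), tipsList_cons, tipsList_cons]
    simp only [size, sizeList, tipsList, List.map_nil, List.sum_nil] at *
    omega

theorem IsBinary.size_eq {t : RTree} (h : t.IsBinary) : t.size = 2 * t.numLeaves := by
  obtain ⟨a, rfl, ha⟩ := isBinary_iff.1 h
  rw [numLeaves_singleton, ← ha.size_eq]
  simp [size, sizeList]

/-- The general bound on `size` plus the root degree leaves room for just one child of the root, and
the tree above it attains equality in `Reduced.size_le`. -/
theorem NoDegreeTwo.isBinary {t : RTree} (h : t.NoDegreeTwo) (h0 : 0 < t.numLeaves)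
    (hs : 2 * t.numLeaves ≤ t.size) : t.IsBinary := by
  have h1 := h.size_add_length_le
  obtain ⟨ts⟩ := t
  rw [noDegreeTwo_node] at h
  simp only [children] at h1
  rcases ts with _ | ⟨a, _ | ⟨b, us⟩⟩
  · simp [numLeaves_node, tipsList] at h0
  · refine isBinary_iff.2 ⟨a, rfl, (h a (by simp)).size_le.2 ?_⟩
    have := (h a (by simp)).size_le.1
    rw [numLeaves_singleton] at *
    simp only [size, sizeList] at *
    omega
  · simp only [List.length_cons] at h1
    omega

theorem Iso.size_eq {t u : RTree} (h : Iso t u) : t.size = u.size := by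
  have key : ∀ ts : List RTree, sizeList ts = ∑ i : Fin ts.length, (ts.get i).size := by
    intro ts
    induction ts with
    | nil => simp [sizeList]
    | cons t ts ih =>
      rw [sizeList, ih]
      exact (Fin.sum_univ_succ fun i : Fin (t :: ts).length => ((t :: ts).get i).size).symm
  induction h with
  | node ts us σ h ih =>
    rw [size, size, key, key, ← σ.sum_comp]
    simp only [ih]

/-- A tree with at most `m + 1` vertices is a list of at most `m` trees with at most `m` vertices
each. -/
theorem finite_size_le (m : ℕ) : {t : RTree | t.size ≤ m}.Finite := by
  induction m with
  | zero =>
    refine Set.finite_empty.subset ?_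
    rintro ⟨ts⟩ h
    simp [size] at h
  | succ m ih =>
    have : Finite {t : RTree | t.size ≤ m} := ih
    have h1 : {l : List {t : RTree | t.size ≤ m} | l.length ≤ m}.Finite :=
      List.finite_length_le _ _
    have key : ∀ ts : List RTree, (∀ s ∈ ts, s.size ≤ sizeList ts) ∧ ts.length ≤ sizeList ts := by
      intro ts
      induction ts with
      | nil => simp
      | cons t ts ih =>
        obtain ⟨h2, h3⟩ := ih
        have h4 : 0 < t.size := by obtain ⟨us⟩ := t; simp [size]
        refine ⟨fun s hs => ?_, by rw [sizeList, List.length_cons]; omega⟩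
        rw [sizeList]
        rcases List.mem_cons.1 hs with rfl | hs
        · omega
        · have := h2 s hs; omega
    refine (h1.image fun l => node (l.map Subtype.val)).subset ?_
    rintro ⟨ts⟩ h
    have hm : sizeList ts ≤ m := by simpa [size] using h
    obtain ⟨h2, h3⟩ := key ts
    refine ⟨ts.pmap (fun s hs => ⟨s, hs⟩) fun s hs => (h2 s hs).trans hm, ?_, ?_⟩
    · simpa using h3.trans hm
    · simp only [List.map_pmap, List.pmap_eq_map, List.map_id']

end RTree

namespace RTree

/-! ### Merging the branches to the two leaves of a cherry -/

theorem replant_congr {S S' : List ℕ → List RTree} {glue glue' : List ℕ → Prop}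
    [DecidablePred glue] [DecidablePred glue'] {xs : List (List ℕ)} (hS : ∀ x ∈ xs, S x = S' x)
    (hg : ∀ x ∈ xs, glue x ↔ glue' x) : replant S glue xs = replant S' glue' xs := by
  induction xs with
  | nil => rfl
  | cons x xs ih =>
    rw [replant, replant, ih (fun y hy => hS y (List.mem_cons_of_mem _ hy))
      (fun y hy => hg y (List.mem_cons_of_mem _ hy)), hS x (by simp)]
    simp only [hg x (by simp)]

theorem replant_map (S : List ℕ → List RTree) (glue : List ℕ → Prop) [DecidablePred glue]
    (f : List ℕ → List ℕ) (xs : List (List ℕ)) :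
    replant S glue (xs.map f) = replant (fun x => S (f x)) (fun x => glue (f x)) xs := by
  induction xs with
  | nil => rfl
  | cons x xs ih => rw [List.map_cons, replant, replant, ih]

theorem replant_filter_ne {S : List ℕ → List RTree} {glue : List ℕ → Prop} [DecidablePred glue]
    {c : List ℕ} (hg : glue c) (hS : S c = []) (xs : List (List ℕ)) :
    replant S glue (xs.filter (· ≠ c)) = replant S glue xs := by
  induction xs with
  | nil => rfl
  | cons x xs ih =>
    by_cases h : x = c
    · subst h
      rw [List.filter_cons_of_neg (by simp), ih, replant, if_pos hg, hS, List.nil_append]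
    · rw [List.filter_cons_of_pos (by simpa using h), replant, replant, ih]

theorem replant_ne_nil (S : List ℕ → List RTree) (glue : List ℕ → Prop) [DecidablePred glue]
    (xs : List (List ℕ)) : replant S glue xs ≠ [] := by
  induction xs with
  | nil => simp [replant]
  | cons x xs ih => unfold replant; split <;> simp [ih]

/-- Merging cuts a branch into consecutive pieces and keeps their order. So once the entries of `B`
are filtered out, the entries of `A` appear as in `A`, whatever the cut points are. -/
theorem filter_mergeBranches {f : List ℕ → Bool} {A B : List (List ℕ)} (hB : ∀ b ∈ B, ¬ f b)
    (xs : List (List ℕ)) : (mergeBranches [A, [], B] xs).filter f = A.filter f := by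
  induction xs generalizing A B with
  | nil => simpa [mergeBranches] using hB
  | cons x xs ih =>
    have h1 : cutOff x A ++ remaining x A = A := by
      unfold cutOff remaining; split <;> simp
    have h2 : cutOff x B ++ remaining x B = B := by
      unfold cutOff remaining; split <;> simp
    have h3 : (cutOff x B).filter f = [] := by
      rw [List.filter_eq_nil_iff]
      exact fun b hb => hB b (h2 ▸ List.mem_append_left _ hb)
    have h4 : ∀ b ∈ remaining x B, ¬ f b := fun b hb => hB b (h2 ▸ List.mem_append_right _ hb)
    have h5 : remaining x [] = [] := by simp [remaining]
    have h6 : cutOff x [] = [] := by simp [cutOff]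
    simp only [mergeBranches, List.flatMap_cons, List.flatMap_nil, List.map_cons, List.map_nil,
      h5, h6, List.filter_append, ih h4, h3, List.append_nil, List.nil_append]
    rw [← List.filter_append, h1]

theorem sub_append {t s : RTree} {x : List ℕ} (h : t.sub x = some s) (y : List ℕ) :
    t.sub (x ++ y) = s.sub y := by
  induction x generalizing t with
  | nil => rw [sub_nil, Option.some.injEq] at h; rw [h, List.nil_append]
  | cons i x ih =>
    obtain ⟨ts⟩ := t
    obtain ⟨hi, hu⟩ := lt_of_sub_cons h
    rw [List.cons_append, sub_cons_of_lt hi, ih hu]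

theorem meet_append (x y z : List ℕ) : meet (x ++ y) (x ++ z) = x ++ meet y z := by
  induction x with
  | nil => rfl
  | cons i x ih => rw [List.cons_append, List.cons_append, meet_cons_self, ih, List.cons_append]

theorem iso_graft_cons {ts : List RTree} {i : ℕ} (hi : i < ts.length) {x : List ℕ} {r s : RTree}
    (p q : List ℕ) (h : Iso s (ts[i].graft x r)) :
    Iso (node (hanging (node ts) (i :: p) (i :: q) [] ++ [s])) ((node ts).graft (i :: x) r) := by
  have h1 : (hanging (node ts) (i :: p) (i :: q) []).Perm (ts.eraseIdx i) :=
    ((perm_hanging_self hi p q).symm.trans (List.getElem_cons_eraseIdx_perm hi).symm).cons_inv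
  have h2 : ts.modify i (fun s => s.graft x r) = ts.set i (ts[i].graft x r) := by
    apply List.ext_getElem (by simp)
    intro k _ _
    rw [List.getElem_modify, List.getElem_set]
    split
    · next hk => subst hk; rfl
    · rfl
  rw [graft_node_cons, h2]
  refine (Iso.of_perm ?_).trans ((h.cons (Iso.refl (node (ts.eraseIdx i)))).trans
    (Iso.of_perm (List.set_perm_cons_eraseIdx hi _).symm))
  exact (List.perm_append_singleton _ _).trans (h1.cons s)

theorem take_append_of_mem {c d : List ℕ} {k : ℕ} (hk : k ∈ List.range c.length) :
    (c ++ d).take k = c.take k :=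
  List.take_append_of_le_length (List.mem_range.1 hk).le

/-- A spine that follows a path of `t` unchanged rebuilds `t`, up to the order of siblings, with the
subtree above the end of the path replaced by the final leaf. The words `d` and `e` only continue
the path to the two merged leaves. -/
theorem replant_path {t : RTree} {c : List ℕ} (hc : (t.sub c).isSome) (d e : List ℕ) :
    ∃ s, replant (hanging t (c ++ d) (c ++ e)) (fun _ => False)
      ((List.range c.length).map fun k => c.take k) = [s] ∧ Iso s (t.graft c (node [])) := by
  induction c generalizing t with
  | nil => exact ⟨node [], by simp [replant], by rw [graft_nil]; exact Iso.refl _⟩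
  | cons i c ih =>
    obtain ⟨ts⟩ := t
    obtain ⟨u, hu⟩ := Option.isSome_iff_exists.1 hc
    obtain ⟨hi, hu⟩ := lt_of_sub_cons hu
    obtain ⟨s, hs, hiso⟩ := ih (t := ts[i]) (by simp [hu])
    refine ⟨_, ?_, iso_graft_cons hi (c ++ d) (c ++ e) hiso⟩
    have h : ((List.range (i :: c).length).map fun k => (i :: c).take k) =
        [] :: ((List.range c.length).map fun k => c.take k).map (List.cons i) := by
      simp [List.range_succ_eq_map, Function.comp_def]
    rw [h, replant, if_neg id, replant_map, ← hs]
    simp only [List.cons_append, hanging_cons_self hi]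

/-- Here `Ω = c`, the second branch is empty and the third is `[c]`. As `c` is glued and carries no
subtrees, its position on the spine is irrelevant, and what is left is the path from the root to `c`
in its old order. -/
theorem branchMerge_cherry {w : RTree} {c : List ℕ} (hc0 : c ≠ [])
    (hc : w.sub c = some cherry) (labels : List (List ℕ)) :
    Iso (w.branchMerge (c ++ [0]) (c ++ [1]) labels) (w.graft c (node [])) := by
  have hm : meet (c ++ [0]) (c ++ [1]) = c := by
    rw [meet_append, meet_cons_of_ne (by decide), List.append_nil]
  have hb : branches (c ++ [0]) (c ++ [1]) =
      [(List.range c.length).map fun k => c.take k, [], [c]] := by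
    have h1 : (List.range c.length).map (fun k => (c ++ [0]).take k) =
        (List.range c.length).map fun k => c.take k :=
      List.map_congr_left fun k hk => take_append_of_mem hk
    simp [branches, hm, h1]
  have hS : hanging w (c ++ [0]) (c ++ [1]) c = [] := by
    unfold hanging
    rw [hc]
    rw [List.map_eq_nil_iff, List.filter_eq_nil_iff]
    rintro ⟨k, hk⟩ -
    have hk2 : k < 2 := hk
    have : k = 0 ∨ k = 1 := by omega
    rcases this with rfl | rfl <;> simp
  have hlen : ∀ x ∈ (List.range c.length).map fun k => c.take k, x ≠ c := by
    intro x hx h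
    obtain ⟨k, hk, rfl⟩ := List.mem_map.1 hx
    have := congrArg List.length h
    rw [List.mem_range] at hk
    rw [List.length_take] at this
    omega
  rw [branchMerge, hb, ← replant_filter_ne (c := c) (Or.inr hm.symm) hS,
    filter_mergeBranches (by simp), List.filter_eq_self.2 fun x hx => by simpa using hlen x hx,
    replant_congr (glue' := fun x => x = []) (fun _ _ => rfl)
      (fun x hx => by rw [hm]; exact or_iff_left (hlen x hx))]
  obtain _ | ⟨i, c⟩ := c
  · exact absurd rfl hc0
  · obtain ⟨ts⟩ := w
    obtain ⟨hi, hu⟩ := lt_of_sub_cons hc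
    obtain ⟨s, hs, hiso⟩ := replant_path (t := ts[i]) (c := c) (by simp [hu]) [0] [1]
    have h : ((List.range (i :: c).length).map fun k => (i :: c).take k) =
        [] :: ((List.range c.length).map fun k => c.take k).map (List.cons i) := by
      simp [List.range_succ_eq_map, Function.comp_def]
    rw [h, replant, if_pos rfl, replant_map,
      replant_congr (glue' := fun _ => False) (fun _ _ => rfl) (by simp)]
    simp only [List.cons_append, hanging_cons_self hi, hs]
    exact iso_graft_cons hi _ _ hiso

/-! ### Merging branches at a vertex of high degree -/

theorem exists_sub_eq_leaf (t : RTree) : ∃ x, t.sub x = some (node []) := by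
  induction t using induct with
  | h ts ih =>
    rcases ts with _ | ⟨a, us⟩
    · exact ⟨[], sub_nil _⟩
    · obtain ⟨x, hx⟩ := ih a (by simp)
      exact ⟨0 :: x, hx⟩

theorem exists_isLeaf_append {t s : RTree} {v : List ℕ} (h : t.sub v = some s) {i : ℕ}
    (hi : i < s.children.length) : ∃ x, t.IsLeaf (v ++ i :: x) := by
  obtain ⟨ts⟩ := s
  obtain ⟨x, hx⟩ := exists_sub_eq_leaf ts[i]
  exact ⟨x, by simp, by rw [sub_append h]; exact (sub_cons_of_lt hi x).trans hx⟩

/-- The first label projects to `v = Ω`, the initial vertex of the third branch and of no other. So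
`v` heads the merged spine, is glued to the root, and gives it at least the subtree of child `2`, in
addition to the continuation of the spine. -/
theorem two_le_length_branchMerge {t s : RTree} {v x y z : List ℕ} (h : t.sub v = some s)
    (hs : 3 ≤ s.children.length) (labels : List (List ℕ)) :
    2 ≤ (t.branchMerge (v ++ 0 :: x) (v ++ 1 :: y) ((v ++ 2 :: z) :: labels)).children.length := by
  have hm : ∀ {i j : ℕ} (x y : List ℕ), i ≠ j → meet (v ++ i :: x) (v ++ j :: y) = v := by
    intro i j x y hij
    rw [meet_append, meet_cons_of_ne hij, List.append_nil]
  have hp : proj (v ++ 0 :: x) (v ++ 1 :: y) (v ++ 2 :: z) = v := by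
    simp [proj, hm]
  have hne : hanging t (v ++ 0 :: x) (v ++ 1 :: y) v ≠ [] := by
    unfold hanging
    rw [h]
    refine List.ne_nil_of_mem (a := s.children.get ⟨2, hs⟩) (List.mem_map_of_mem ?_)
    simp
  -- The first branch consists of prefixes shorter than `v`, the second of prefixes longer than `v`;
  -- only the third contains `v`, as its first entry.
  have h1 : cutOff v ((List.range v.length).map fun k => (v ++ 0 :: x).take k) = [] := by
    refine if_neg fun hv => ?_
    obtain ⟨k, hk, hkv⟩ := List.mem_map.1 hv
    have := congrArg List.length hkv
    rw [List.mem_range] at hk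
    rw [List.length_take] at this
    omega
  have h2 : cutOff v ((List.range' (v.length + 1) ((v ++ 0 :: x).length - (v.length + 1))).map
      fun k => (v ++ 0 :: x).take k) = [] := by
    refine if_neg fun hv => ?_
    obtain ⟨k, hk, hkv⟩ := List.mem_map.1 hv
    have := congrArg List.length hkv
    rw [List.mem_range'_1] at hk
    rw [List.length_take] at this
    omega
  have h3 : cutOff v ((List.range' v.length ((v ++ 1 :: y).length - v.length)).map
      fun k => (v ++ 1 :: y).take k) = [v] := by
    simp [cutOff, List.range'_succ]
  have h4 : ∃ xs, mergeBranches (branches (v ++ 0 :: x) (v ++ 1 :: y))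
      (((v ++ 2 :: z) :: labels).map (proj (v ++ 0 :: x) (v ++ 1 :: y))) = v :: xs := by
    rw [List.map_cons, hp]
    simp only [branches, hm x y zero_ne_one, mergeBranches, List.flatMap_cons, List.flatMap_nil,
      h1, h2, h3, List.nil_append, List.append_nil, List.singleton_append]
    exact ⟨_, rfl⟩
  obtain ⟨xs, hxs⟩ := h4
  rw [branchMerge, hxs, replant, if_pos (Or.inr (hm x y zero_ne_one).symm), children,
    List.length_append]
  have h5 := List.length_pos_iff.2 hne
  have h6 := List.length_pos_iff.2 (replant_ne_nil (hanging t (v ++ 0 :: x) (v ++ 1 :: y))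
    (fun w => w = [] ∨ w = meet (v ++ 0 :: x) (v ++ 1 :: y)) xs)
  omega

end RTree

namespace BranchMerging

section Chains

variable {S : Type}

/-! ### Convergence of finite Markov chains -/

theorem law_zero (P : S → PMF S) (μ : PMF S) : law P μ 0 = μ := rfl

theorem law_succ (P : S → PMF S) (μ : PMF S) (k : ℕ) :
    law P μ (k + 1) = (law P μ k).bind P := Function.iterate_succ_apply' _ _ _

theorem law_add (P : S → PMF S) (μ : PMF S) (j k : ℕ) :
    law P μ (j + k) = law P (law P μ j) k := by
  rw [add_comm]; exact Function.iterate_add_apply _ _ _ _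

theorem law_eq_bind (P : S → PMF S) (μ : PMF S) (k : ℕ) :
    law P μ k = μ.bind fun x => law P (PMF.pure x) k := by
  induction k with
  | zero => simp only [law_zero, PMF.bind_pure]
  | succ k ih => simp only [law_succ, ih, PMF.bind_bind]

theorem law_ne_zero_iff {P : S → PMF S} {μ : PMF S} {k : ℕ} {y : S} :
    law P μ k y ≠ 0 ↔ ∃ x, μ x ≠ 0 ∧ law P (PMF.pure x) k y ≠ 0 := by
  rw [law_eq_bind, ← PMF.mem_support_iff, PMF.mem_support_bind_iff]
  simp only [PMF.mem_support_iff]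

theorem law_pure_add_ne_zero {P : S → PMF S} {x y z : S} {j k : ℕ}
    (h : law P (PMF.pure x) j y ≠ 0) (h' : law P (PMF.pure y) k z ≠ 0) :
    law P (PMF.pure x) (j + k) z ≠ 0 := by
  rw [law_add, law_ne_zero_iff]
  exact ⟨y, h, h'⟩

theorem Accessible.refl (P : S → PMF S) (x : S) : Accessible P x x := ⟨0, by simp [law_zero]⟩

theorem Accessible.trans {P : S → PMF S} {x y z : S} (h : Accessible P x y)
    (h' : Accessible P y z) : Accessible P x z :=
  ⟨_, law_pure_add_ne_zero h.choose_spec h'.choose_spec⟩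

theorem law_pure_one (P : S → PMF S) (x : S) : law P (PMF.pure x) 1 = P x := by
  rw [law_succ, law_zero, PMF.pure_bind]

theorem Accessible.of_ne_zero {P : S → PMF S} {x y : S} (h : P x y ≠ 0) : Accessible P x y :=
  ⟨1, by rwa [law_pure_one]⟩

theorem Accessible.mem_of_closed {P : S → PMF S} {C : Set S}
    (hC : ∀ x ∈ C, ∀ y, P x y ≠ 0 → y ∈ C) {x y : S} (hx : x ∈ C) (h : Accessible P x y) :
    y ∈ C := by
  obtain ⟨k, hk⟩ := h
  induction k generalizing y with
  | zero =>
    obtain rfl : y = x := by simpa [law_zero] using hk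
    exact hx
  | succ k ih =>
    rw [law_succ, ← PMF.mem_support_iff, PMF.mem_support_bind_iff] at hk
    obtain ⟨z, hz, hzy⟩ := hk
    exact hC z (ih hz) y hzy

/-- A closed class must contain `b`, because `b` is accessible from each of its states. -/
theorem isCommunicatingClass_and_isClosedSet_iff {P : S → PMF S} {b : S}
    (hb : ∀ x, Accessible P x b) (C : Set S) :
    (IsCommunicatingClass P C ∧ IsClosedSet P C) ↔ C = {y | Accessible P b y} := by
  constructor
  · rintro ⟨⟨x, rfl⟩, hC⟩
    obtain ⟨h1, h2⟩ := hC x ⟨.refl P x, .refl P x⟩ b (hb x)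
    ext y
    exact ⟨fun h => h2.trans h.1, fun h => ⟨h1.trans h, (hb y).trans h2⟩⟩
  · rintro rfl
    refine ⟨⟨b, ?_⟩, fun x hx y hxy => hx.trans hxy⟩
    ext y
    exact ⟨fun h => ⟨h, hb y⟩, fun h => h.1⟩

-- Contraction in `ℓ¹` distance and the limit law

variable [Fintype S]

/-- The `ℓ¹` distance of two distributions. -/
noncomputable def l1Dist (μ ν : PMF S) : ℝ := ∑ y, |(μ y).toReal - (ν y).toReal|

theorem sum_toReal (μ : PMF S) : ∑ y, (μ y).toReal = 1 := by
  rw [← ENNReal.toReal_sum fun y _ => μ.apply_ne_top y, ← tsum_fintype (L := .unconditional S),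
    μ.tsum_coe, ENNReal.toReal_one]

theorem toReal_bind (μ : PMF S) (Q : S → PMF S) (y : S) :
    (μ.bind Q y).toReal = ∑ x, (μ x).toReal * (Q x y).toReal := by
  rw [PMF.bind_apply, tsum_fintype, ENNReal.toReal_sum fun x _ =>
    ENNReal.mul_ne_top (μ.apply_ne_top x) ((Q x).apply_ne_top y)]
  simp only [ENNReal.toReal_mul]

theorem l1Dist_le_two (μ ν : PMF S) : l1Dist μ ν ≤ 2 := by
  calc l1Dist μ ν ≤ ∑ y, ((μ y).toReal + (ν y).toReal) := Finset.sum_le_sum fun y _ => by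
        have h1 : 0 ≤ (μ y).toReal := ENNReal.toReal_nonneg
        have h2 : 0 ≤ (ν y).toReal := ENNReal.toReal_nonneg
        rw [abs_le]; constructor <;> linarith
    _ = 2 := by rw [Finset.sum_add_distrib, sum_toReal, sum_toReal]; norm_num

theorem abs_sub_le_l1Dist (μ ν : PMF S) (y : S) :
    |(μ y).toReal - (ν y).toReal| ≤ l1Dist μ ν :=
  Finset.single_le_sum (f := fun y => |(μ y).toReal - (ν y).toReal|)
    (fun _ _ => abs_nonneg _) (Finset.mem_univ y)

/-- Doeblin's bound: the common mass `ε` at `b` can be subtracted from every row of `Q` without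
changing the difference of the images, since `μ - ν` has total mass zero. The remaining nonnegative
rows have sum `1 - ε`. -/
theorem l1Dist_bind_le {Q : S → PMF S} {b : S} {ε : ℝ} (h : ∀ x, ε ≤ (Q x b).toReal)
    (μ ν : PMF S) : l1Dist (μ.bind Q) (ν.bind Q) ≤ (1 - ε) * l1Dist μ ν := by
  classical
  set δ : S → ℝ := fun x => (μ x).toReal - (ν x).toReal with hδ
  set R : S → S → ℝ := fun x y => (Q x y).toReal - if y = b then ε else 0 with hR
  have hδ0 : ∑ x, δ x = 0 := by
    rw [hδ, Finset.sum_sub_distrib, sum_toReal, sum_toReal, sub_self]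
  have hR0 : ∀ x y, 0 ≤ R x y := by
    intro x y
    simp only [hR]
    split
    · next hy => subst hy; linarith [h x]
    · simp
  have hR1 : ∀ x, ∑ y, R x y = 1 - ε := by
    intro x
    simp [hR, Finset.sum_sub_distrib, sum_toReal]
  have key : ∀ y, (μ.bind Q y).toReal - (ν.bind Q y).toReal = ∑ x, δ x * R x y := by
    intro y
    simp only [hR, mul_sub, Finset.sum_sub_distrib, ← Finset.sum_mul, hδ0, zero_mul, sub_zero]
    simp only [hδ, sub_mul, Finset.sum_sub_distrib, toReal_bind]
  calc l1Dist (μ.bind Q) (ν.bind Q) = ∑ y, |∑ x, δ x * R x y| := by simp only [l1Dist, key]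
    _ ≤ ∑ y, ∑ x, |δ x| * R x y := Finset.sum_le_sum fun y _ =>
        (Finset.abs_sum_le_sum_abs _ _).trans_eq
          (Finset.sum_congr rfl fun x _ => by rw [abs_mul, abs_of_nonneg (hR0 x y)])
    _ = ∑ x, |δ x| * (1 - ε) := by
        rw [Finset.sum_comm]
        exact Finset.sum_congr rfl fun x _ => by rw [← Finset.mul_sum, hR1]
    _ = (1 - ε) * l1Dist μ ν := by rw [← Finset.sum_mul, mul_comm]; rfl

/-- If a state with a loop is accessible from everywhere, then a finite chain forgets its initial
distribution, uniformly. -/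
theorem exists_tendsto_zero_l1Dist_law_le {P : S → PMF S} {b : S} (hb : ∀ x, Accessible P x b)
    (hbb : P b b ≠ 0) : ∃ r : ℕ → ℝ, Filter.Tendsto r Filter.atTop (nhds 0) ∧
      ∀ μ ν k, l1Dist (law P μ k) (law P ν k) ≤ r k := by
  have hloop : ∀ k, law P (PMF.pure b) k b ≠ 0 := by
    intro k
    induction k with
    | zero => simp [law_zero]
    | succ k ih => exact law_pure_add_ne_zero ih (by rwa [law_pure_one])
  choose m hm using hb
  set N := ∑ x, m x + 1
  have hpos : ∀ x, 0 < (law P (PMF.pure x) N b).toReal := by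
    intro x
    refine ENNReal.toReal_pos ?_ (PMF.apply_ne_top _ _)
    have hx : m x ≤ N := (Finset.single_le_sum (fun _ _ => Nat.zero_le _)
      (Finset.mem_univ x)).trans (Nat.le_succ _)
    rw [← Nat.add_sub_cancel' hx]
    exact law_pure_add_ne_zero (hm x) (hloop _)
  have hN0 : N ≠ 0 := Nat.succ_ne_zero _
  clear_value N
  have : Nonempty S := ⟨b⟩
  obtain ⟨x₀, hx₀⟩ := Finite.exists_min fun x => (law P (PMF.pure x) N b).toReal
  set ε := (law P (PMF.pure x₀) N b).toReal
  have hε0 : 0 < ε := hpos x₀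
  have hε1 : ε ≤ 1 := by
    have := PMF.coe_le_one (law P (PMF.pure x₀) N) b
    exact ENNReal.toReal_le_of_le_ofReal zero_le_one (by simpa using this)
  -- Monotonicity in time is the contraction estimate with `ε = 0`; it handles the incomplete last
  -- block.
  have hone : ∀ μ ν j, l1Dist (law P μ j) (law P ν j) ≤ l1Dist μ ν := by
    intro μ ν j
    induction j with
    | zero => exact le_rfl
    | succ j ih =>
      rw [law_succ, law_succ]
      refine le_trans ?_ ih
      simpa using l1Dist_bind_le (Q := P) (b := b) (ε := 0)
        (fun _ => ENNReal.toReal_nonneg) (law P μ j) (law P ν j)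
  have hmul : ∀ μ ν q, l1Dist (law P μ (N * q)) (law P ν (N * q)) ≤ (1 - ε) ^ q * 2 := by
    intro μ ν q
    induction q with
    | zero => simpa using l1Dist_le_two _ _
    | succ q ih =>
      rw [Nat.mul_succ, law_add, law_add, law_eq_bind P _ N, law_eq_bind P (law P ν _) N, pow_succ',
        mul_assoc]
      exact (l1Dist_bind_le hx₀ _ _).trans
        (mul_le_mul_of_nonneg_left ih (by linarith))
  refine ⟨fun k => (1 - ε) ^ (k / N) * 2, ?_, fun μ ν k => ?_⟩
  · have h1 := tendsto_pow_atTop_nhds_zero_of_lt_one (r := 1 - ε) (by linarith) (by linarith)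
    simpa using (h1.comp (Nat.tendsto_div_const_atTop hN0)).mul_const 2
  · conv_lhs => rw [← Nat.div_add_mod k N, law_add, law_add]
    exact (hone _ _ _).trans (hmul μ ν _)

/-- Since the bound `r` is uniform in the initial laws, the law at time `i ≥ k` can be viewed as `k`
steps started from the law at time `i - k`. This makes the laws started from `b` Cauchy; the limit
is stationary, and all other initial laws are drawn to it. -/
theorem exists_stationary_tendsto {P : S → PMF S} {b : S} (hb : ∀ x, Accessible P x b)
    (hbb : P b b ≠ 0) : ∃ π : PMF S, IsStationary P π ∧ (∀ π', IsStationary P π' → π' = π) ∧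
      π.support = {y | Accessible P b y} ∧
      ∀ μ y, Filter.Tendsto (fun k => law P μ k y) Filter.atTop (nhds (π y)) := by
  obtain ⟨r, hr, hrk⟩ := exists_tendsto_zero_l1Dist_law_le hb hbb
  have hcauchy : ∀ y, CauchySeq fun k => (law P (PMF.pure b) k y).toReal := by
    intro y
    refine cauchySeq_of_le_tendsto_0 r (fun i j k hi hj => ?_) hr
    rw [← Nat.sub_add_cancel hi, ← Nat.sub_add_cancel hj, law_add, law_add, Real.dist_eq]
    exact (abs_sub_le_l1Dist _ _ y).trans (hrk _ _ k)
  choose L hL using fun y => cauchySeq_tendsto_of_complete (hcauchy y)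
  have hL0 : ∀ y, 0 ≤ L y := fun y => ge_of_tendsto' (hL y) fun _ => ENNReal.toReal_nonneg
  have hL1 : ∑ y, L y = 1 := by
    refine tendsto_nhds_unique (tendsto_finsetSum _ fun y _ => hL y) ?_
    simp only [sum_toReal]
    exact tendsto_const_nhds
  let π : PMF S := PMF.ofFintype (fun y => ENNReal.ofReal (L y)) (by
    rw [← ENNReal.ofReal_sum_of_nonneg fun y _ => hL0 y, hL1, ENNReal.ofReal_one])
  have hπ : ∀ y, (π y).toReal = L y := fun y => ENNReal.toReal_ofReal (hL0 y)
  have hconv : ∀ μ y, Filter.Tendsto (fun k => law P μ k y) Filter.atTop (nhds (π y)) := by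
    intro μ y
    rw [← ENNReal.tendsto_toReal_iff (fun _ => PMF.apply_ne_top _ _) (PMF.apply_ne_top _ _), hπ]
    have h1 : Filter.Tendsto (fun k => (law P μ k y).toReal - (law P (PMF.pure b) k y).toReal)
        Filter.atTop (nhds 0) :=
      squeeze_zero_norm (fun k => (abs_sub_le_l1Dist _ _ y).trans (hrk _ _ k)) hr
    simpa using h1.add (hL y)
  have hstat : IsStationary P π := by
    refine PMF.ext fun y => ?_
    rw [← ENNReal.toReal_eq_toReal_iff' (PMF.apply_ne_top _ _) (PMF.apply_ne_top _ _),
      toReal_bind, hπ]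
    simp only [hπ]
    refine tendsto_nhds_unique
      (tendsto_finsetSum _ fun x _ => (hL x).mul_const (P x y).toReal) ?_
    simp only [← toReal_bind, ← law_succ]
    exact (hL y).comp (Filter.tendsto_add_atTop_nat 1)
  have hlaw : ∀ π', IsStationary P π' → ∀ k, law P π' k = π' := by
    intro π' h k
    induction k with
    | zero => rfl
    | succ k ih => rw [law_succ, ih]; exact h
  refine ⟨π, hstat, fun π' h => PMF.ext fun y => ?_, ?_, hconv⟩
  · have := hconv π' y
    simp only [hlaw π' h] at this
    exact tendsto_nhds_unique tendsto_const_nhds this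
  · ext y
    rw [PMF.mem_support_iff, Set.mem_ofPred_eq]
    constructor
    · intro h
      by_contra h'
      have hz : ∀ k, law P (PMF.pure b) k y = 0 := by
        intro k
        by_contra hk
        exact h' ⟨k, hk⟩
      have := hconv (PMF.pure b) y
      simp only [hz] at this
      exact h (tendsto_nhds_unique this tendsto_const_nhds)
    -- By stationarity `π` is its own law at time `j + k`, and some state charged by `π` leads to
    -- `b` in `j` steps and on to `y` in `k` steps.
    · rintro ⟨k, hk⟩
      obtain ⟨x, hx⟩ := π.support_nonempty
      obtain ⟨j, hj⟩ := hb x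
      rw [← hlaw π hstat (j + k), law_ne_zero_iff]
      exact ⟨x, hx, law_pure_add_ne_zero hj hk⟩

end Chains

end BranchMerging

namespace BranchMerging

/-! ### The steps of the branch merging chain -/

theorem support_uniform (α : Type) [Finite α] [Nonempty α] : (uniform α).support = Set.univ := by
  let := Fintype.ofFinite α
  exact PMF.support_uniformOfFintype α

theorem mem_support_planeStep_iff {n : ℕ} (hn : 2 ≤ n) {t u : PlaneTree n} :
    u ∈ (planeStep hn t).support ↔ ∃ e z ℓ, mergeAt (insertAt t e) z ℓ = u := by
  simp only [planeStep, PMF.mem_support_bind_iff, PMF.mem_support_map_iff, support_uniform,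
    Set.mem_univ, true_and]

theorem out_mk_iso {n : ℕ} (t : PlaneTree n) :
    (Quotient.out (Quotient.mk _ t : UnlabelledTree n)).1.Iso t.1 :=
  Quotient.mk_out (s := isoSetoid n) t

theorem step_ne_zero_iff {n : ℕ} (hn : 2 ≤ n) {x y : UnlabelledTree n} :
    step hn x y ≠ 0 ↔ ∃ e z ℓ, (Quotient.mk _ (mergeAt (insertAt (Quotient.out x) e) z ℓ) :
      UnlabelledTree n) = y := by
  rw [← PMF.mem_support_iff]
  refine (PMF.mem_support_map_iff _ _ _).trans ?_
  simp only [mem_support_planeStep_iff]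
  constructor
  · rintro ⟨_, ⟨e, z, ℓ, rfl⟩, h⟩
    exact ⟨e, z, ℓ, h⟩
  · rintro ⟨e, z, ℓ, h⟩
    exact ⟨_, ⟨e, z, ℓ, rfl⟩, h⟩

/-- A step is possible for every choice of an edge, of two distinct leaves, and of the leaf with the
first label. -/
theorem exists_step {n : ℕ} (hn : 2 ≤ n) (x : UnlabelledTree n) {e p q : List ℕ}
    (he : (Quotient.out x).1.IsEdge e) (hp : ((Quotient.out x).1.insertLeaf e).IsLeaf p)
    (hq : ((Quotient.out x).1.insertLeaf e).IsLeaf q) (hpq : p ≠ q) :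
    ∃ y labels, step hn x y ≠ 0 ∧
      ((Quotient.out x).1.insertLeaf e |>.branchMerge p q labels).Iso (Quotient.out y).1 := by
  set w := insertAt (Quotient.out x) ⟨e, he⟩
  let z : LeafPair w.1 := ⟨(⟨p, hp⟩, ⟨q, hq⟩), fun h => hpq (congrArg Subtype.val h)⟩
  obtain ⟨ℓ⟩ := nonempty_allocation w z
  exact ⟨Quotient.mk _ (mergeAt w z ℓ), _, (step_ne_zero_iff hn).2 ⟨⟨e, he⟩, z, ℓ, rfl⟩,
    (out_mk_iso (mergeAt w z ℓ)).symm⟩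

theorem exists_step_of_label {n : ℕ} (hn : 2 ≤ n) (x : UnlabelledTree n) {e p q r : List ℕ}
    (he : (Quotient.out x).1.IsEdge e) (hp : ((Quotient.out x).1.insertLeaf e).IsLeaf p)
    (hq : ((Quotient.out x).1.insertLeaf e).IsLeaf q)
    (hr : ((Quotient.out x).1.insertLeaf e).IsLeaf r) (hpq : p ≠ q) (hrp : r ≠ p) (hrq : r ≠ q) :
    ∃ y labels, step hn x y ≠ 0 ∧
      ((Quotient.out x).1.insertLeaf e |>.branchMerge p q (r :: labels)).Iso
        (Quotient.out y).1 := by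
  set w := insertAt (Quotient.out x) ⟨e, he⟩
  let z : LeafPair w.1 := ⟨(⟨p, hp⟩, ⟨q, hq⟩), fun h => hpq (congrArg Subtype.val h)⟩
  obtain ⟨ℓ₀⟩ := nonempty_allocation w z
  have ℓ₁ : Fin (n - 1) ≃ {r : w.1.Leaf // r ≠ z.1.1 ∧ r ≠ z.1.2} := ℓ₀
  let r' : {r : w.1.Leaf // r ≠ z.1.1 ∧ r ≠ z.1.2} :=
    ⟨⟨r, hr⟩, fun h => hrp (congrArg Subtype.val h), fun h => hrq (congrArg Subtype.val h)⟩
  -- Swapping two labels moves `r` to the first one, which exists because `n ≥ 2`.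
  let ℓ : Allocation z (n - 1) := (Equiv.swap ⟨0, by omega⟩ (ℓ₁.symm r')).trans ℓ₁
  have hℓ : ℓ.toFun ⟨0, by omega⟩ = r' := by
    change ℓ₁ (Equiv.swap _ _ _) = r'
    rw [Equiv.swap_apply_left, Equiv.apply_symm_apply]
  have hl : ∃ labels, List.ofFn (fun k => (ℓ.toFun k).1.1) = r :: labels := by
    have h0 : ∀ (m : ℕ) (hm : 0 < m) (f : Fin m → List ℕ), f ⟨0, hm⟩ = r →
        ∃ labels, List.ofFn f = r :: labels := by
      rintro (_ | m) hm f rfl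
      · omega
      · exact ⟨_, List.ofFn_succ⟩
    exact h0 _ (by omega) _ (by rw [hℓ])
  obtain ⟨labels, hl⟩ := hl
  refine ⟨Quotient.mk _ (mergeAt w z ℓ), labels, (step_ne_zero_iff hn).2 ⟨⟨e, he⟩, z, ℓ, rfl⟩, ?_⟩
  rw [← hl]
  exact (out_mk_iso (mergeAt w z ℓ)).symm

theorem mem_binaryTrees_iff {n : ℕ} {x : UnlabelledTree n} :
    x ∈ binaryTrees n ↔ (Quotient.out x).1.IsBinary := by
  constructor
  · rintro ⟨t, ht, rfl⟩
    exact ht.of_iso (out_mk_iso t).symm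
  · exact fun h => ⟨_, h, Quotient.out_eq x⟩

/-- A binary tree has the maximal number `2 * n` of vertices, the insertion adds two and the merging
takes away at most two. -/
theorem mem_binaryTrees_of_step {n : ℕ} (hn : 2 ≤ n) {x y : UnlabelledTree n}
    (hx : x ∈ binaryTrees n) (h : step hn x y ≠ 0) : y ∈ binaryTrees n := by
  rw [mem_binaryTrees_iff] at hx
  obtain ⟨e, z, ℓ, rfl⟩ := (step_ne_zero_iff hn).1 h
  refine ⟨_, ?_, rfl⟩
  have h1 := RTree.size_branchMerge z.1.1.2 z.1.2.2 (fun h => z.2 (Subtype.ext h))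
      (List.ofFn fun k => (ℓ.toFun k).1.1)
  have h2 : (insertAt (Quotient.out x) e).1.size = (Quotient.out x).1.size + 2 :=
    RTree.size_insertLeaf _ _ e.2.2
  have h3 := hx.size_eq
  have h4 := (mergeAt _ z ℓ).2.1
  have h5 := (Quotient.out x).2.1
  refine (mergeAt _ z ℓ).2.2.isBinary (by omega) ?_
  have h6 : (mergeAt _ z ℓ).1.size + (if RTree.meet z.1.1.1 z.1.2.1 = [] then 1 else 2) =
    (insertAt (Quotient.out x) e).1.size := h1
  split at h6 <;> omega

/-! ### Accessibility of the binary trees -/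

/-- Insert the new leaf at a leaf edge to obtain the common split, then merge the two leaves of the
cherry whose collapse gives `u`. -/
theorem exists_step_of_cherryMove {n : ℕ} (hn : 2 ≤ n) (x : UnlabelledTree n) {t u : RTree}
    (hx : (Quotient.out x).1.Iso t) (h : RTree.CherryMove t u) :
    ∃ y, step hn x y ≠ 0 ∧ (Quotient.out y).1.Iso u := by
  obtain ⟨w, htw, huw⟩ := h
  obtain ⟨e, he, hw⟩ := htw.of_iso_left hx.symm
  rw [← RTree.insertLeaf_eq_graft he.2] at hw
  obtain ⟨c, hc0, hc, hcu⟩ := (huw.of_iso_right hw.symm).exists_cherry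
  obtain ⟨y, labels, hy, hiso⟩ := exists_step hn x (p := c ++ [0]) (q := c ++ [1])
    ⟨he.1, by simp [he.2]⟩ ⟨by simp, by rw [RTree.sub_append hc]; rfl⟩
    ⟨by simp, by rw [RTree.sub_append hc]; rfl⟩ (by simp)
  exact ⟨y, hy, hiso.symm.trans ((RTree.branchMerge_cherry hc0 hc labels).trans hcu)⟩

theorem accessible_of_reflTransGen {n : ℕ} (hn : 2 ≤ n) (x : UnlabelledTree n) {t u : RTree}
    (hx : (Quotient.out x).1.Iso t) (h : Relation.ReflTransGen RTree.CherryMove t u) :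
    ∃ y, Accessible (step hn) x y ∧ (Quotient.out y).1.Iso u := by
  induction h with
  | refl => exact ⟨x, .refl _ x, hx⟩
  | tail _ h ih =>
    obtain ⟨y, hxy, hy⟩ := ih
    obtain ⟨z, hyz, hz⟩ := exists_step_of_cherryMove hn y hy h
    exact ⟨z, hxy.trans (.of_ne_zero hyz), hz⟩

theorem eq_of_iso_out {n : ℕ} {x y : UnlabelledTree n}
    (h : (Quotient.out x).1.Iso (Quotient.out y).1) : x = y := by
  rw [← Quotient.out_eq x, ← Quotient.out_eq y]
  exact Quotient.sound h

theorem accessible_binaryTrees {n : ℕ} (hn : 2 ≤ n) {x y : UnlabelledTree n}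
    (hx : x ∈ binaryTrees n) (hy : y ∈ binaryTrees n) : Accessible (step hn) x y := by
  rw [mem_binaryTrees_iff] at hx hy
  obtain ⟨z, hz, hzy⟩ := accessible_of_reflTransGen hn x (RTree.Iso.refl _)
    (hx.reflTransGen_cherryMove hy ((Quotient.out x).2.1.trans (Quotient.out y).2.1.symm))
  exact eq_of_iso_out hzy ▸ hz

/-- The cherry created by the insertion can be collapsed at once. This loop is the source of
aperiodicity. -/
theorem step_self_ne_zero {n : ℕ} (hn : 2 ≤ n) (x : UnlabelledTree n) : step hn x x ≠ 0 := by
  obtain ⟨⟨e, he⟩⟩ : Nonempty (Quotient.out x).1.Leaf := by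
    have h := (Quotient.out x).2.1
    unfold RTree.numLeaves at h
    exact (Nat.card_pos_iff.1 (by omega)).1
  have h : RTree.Split (Quotient.out x).1 _ := ⟨e, he, RTree.Iso.refl _⟩
  obtain ⟨y, hy, hyx⟩ := exists_step_of_cherryMove hn x (RTree.Iso.refl _) ⟨_, h, h⟩
  rwa [eq_of_iso_out hyx] at hy

/-- With leaves above two different children of the root, `Ω = ρ` and only one of the two inserted
vertices is lost again. -/
theorem exists_size_lt_of_children {n : ℕ} (hn : 2 ≤ n) (x : UnlabelledTree n)
    (hx : 2 ≤ (Quotient.out x).1.children.length) :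
    ∃ y, Accessible (step hn) x y ∧ (Quotient.out x).1.size < (Quotient.out y).1.size := by
  set t := (Quotient.out x).1
  have he : t.IsEdge [0] := by
    refine ⟨by simp, ?_⟩
    rw [RTree.sub, List.getElem?_eq_getElem (by omega), Option.bind_some, RTree.sub_nil]; rfl
  have hw : 2 ≤ (t.insertLeaf [0]).children.length := by
    simpa [RTree.insertLeaf, RTree.children] using hx
  obtain ⟨p, hp⟩ := RTree.exists_isLeaf_append (RTree.sub_nil (t.insertLeaf [0])) (i := 0)
    (by omega)
  obtain ⟨q, hq⟩ := RTree.exists_isLeaf_append (RTree.sub_nil (t.insertLeaf [0])) (i := 1)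
    (by omega)
  obtain ⟨y, labels, hy, hiso⟩ := exists_step hn x he hp hq (by simp)
  refine ⟨y, .of_ne_zero hy, ?_⟩
  have h1 := RTree.size_branchMerge hp hq (by simp) labels
  rw [List.nil_append, List.nil_append, RTree.meet_cons_of_ne zero_ne_one, if_pos rfl,
    RTree.size_insertLeaf _ _ he.2] at h1
  rw [← hiso.size_eq]
  change t.size < (t.insertLeaf [0] |>.branchMerge (0 :: p) (1 :: q) labels).size
  omega

theorem exists_size_lt {n : ℕ} (hn : 2 ≤ n) (x : UnlabelledTree n) (hx : x ∉ binaryTrees n) :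
    ∃ y, Accessible (step hn) x y ∧ (Quotient.out x).1.size < (Quotient.out y).1.size := by
  rw [mem_binaryTrees_iff] at hx
  by_cases hroot : 2 ≤ (Quotient.out x).1.children.length
  · exact exists_size_lt_of_children hn x hroot
  · obtain ⟨a, v, s, ha, hv, hs⟩ : ∃ a v s, (Quotient.out x).1 = .node [a] ∧
        a.sub v = some s ∧ 3 ≤ s.children.length := by
      obtain ⟨ts, hts⟩ : ∃ ts, (Quotient.out x).1 = .node ts := by
        cases (Quotient.out x).1
        exact ⟨_, rfl⟩
      have hl := (Quotient.out x).2.1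
      have hred := (Quotient.out x).2.2
      rw [hts] at hroot hl hx hred
      rcases ts with _ | ⟨a, _ | ⟨b, us⟩⟩
      · simp [RTree.numLeaves_node, RTree.tipsList] at hl
        omega
      · by_contra! hcon
        refine hx (RTree.isBinary_iff.2 ⟨a, rfl, RTree.full_of_forall fun v s hv => ?_⟩)
        have h1 := hcon a v s hts hv
        have h2 := hred (0 :: v) s (by simp) hv
        omega
      · simp [RTree.children] at hroot
    -- The leaf is inserted at the root edge, so the subtree above `v` is untouched and its address
    -- only becomes longer.
    have hw : (Quotient.out x).1.insertLeaf [0] = .node [.node [a, .node []]] := by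
      rw [ha]; simp [RTree.insertLeaf, RTree.children]
    have hv' : ((Quotient.out x).1.insertLeaf [0]).sub (0 :: 0 :: v) = some s := by
      rw [hw]; exact hv
    have he : (Quotient.out x).1.IsEdge [0] :=
      ⟨by simp, by rw [ha]; simp [RTree.sub_node_cons, RTree.sub_nil]⟩
    obtain ⟨p, hp⟩ := RTree.exists_isLeaf_append hv' (i := 0) (by omega)
    obtain ⟨q, hq⟩ := RTree.exists_isLeaf_append hv' (i := 1) (by omega)
    obtain ⟨r, hr⟩ := RTree.exists_isLeaf_append hv' (i := 2) (by omega)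
    obtain ⟨y, labels, hy, hiso⟩ := exists_step_of_label hn x he hp hq hr (by simp) (by simp)
      (by simp)
    have h1 := RTree.size_branchMerge hp hq (by simp) (((0 :: 0 :: v) ++ 2 :: r) :: labels)
    have h2 := RTree.two_le_length_branchMerge (x := p) (y := q) (z := r) hv' hs labels
    rw [RTree.meet_append, RTree.meet_cons_of_ne zero_ne_one, if_neg (by simp),
      RTree.size_insertLeaf _ _ he.2] at h1
    rw [hiso.length_children] at h2
    rw [hiso.size_eq] at h1
    -- The first step keeps the number of vertices and produces a root with at least two children;
    -- the second one gains a vertex.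
    obtain ⟨z, hyz, hz⟩ := exists_size_lt_of_children hn y h2
    exact ⟨z, .trans (.of_ne_zero hy) hyz, by omega⟩

theorem exists_accessible_binaryTree {n : ℕ} (hn : 2 ≤ n) (x : UnlabelledTree n) :
    ∃ y ∈ binaryTrees n, Accessible (step hn) x y := by
  -- `m` bounds how many more times the number of vertices can grow.
  obtain ⟨m, hm⟩ : ∃ m, 2 * n + 1 ≤ (Quotient.out x).1.size + m := ⟨_, Nat.le_add_left _ _⟩
  induction m generalizing x with
  | zero =>
    have h1 := (Quotient.out x).2.1
    refine ⟨x, mem_binaryTrees_iff.2 ((Quotient.out x).2.2.isBinary (by omega) (by omega)),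
      .refl _ x⟩
  | succ m ih =>
    by_cases hx : x ∈ binaryTrees n
    · exact ⟨x, hx, .refl _ x⟩
    · obtain ⟨y, hxy, hlt⟩ := exists_size_lt hn x hx
      obtain ⟨z, hz, hyz⟩ := ih y (by omega)
      exact ⟨z, hz, hxy.trans hyz⟩

/-! ### The state space -/

instance finite_unlabelledTree (n : ℕ) : Finite (UnlabelledTree n) := by
  have : Finite (PlaneTree n) := by
    refine ((RTree.finite_size_le (2 * n + 1)).subset fun t (ht : t.numLeaves = n ∧ t.NoDegreeTwo) =>
      ?_).to_subtype
    have := ht.2.size_add_length_le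
    rw [ht.1] at this
    exact (Nat.le_add_right _ _).trans this
  exact Quotient.finite _

instance nonempty_unlabelledTree (n : ℕ) : Nonempty (UnlabelledTree n) := by
  refine ⟨Quotient.mk _ ⟨.node (List.replicate n (.node [])), ?_, ?_⟩⟩
  · simp [RTree.numLeaves_node, RTree.tipsList, RTree.tips_leaf]
  · rw [RTree.noDegreeTwo_node]
    intro s hs
    obtain rfl := List.eq_of_mem_replicate hs
    simp [RTree.reduced_node]

end BranchMerging

-- The main theorem

theorem theorem4p2 (n : ℕ) (hn : 2 ≤ n) :
    (∀ C : Set (BranchMerging.UnlabelledTree n),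
      (BranchMerging.IsCommunicatingClass (BranchMerging.step hn) C ∧ BranchMerging.IsClosedSet (BranchMerging.step hn) C) ↔ C = BranchMerging.binaryTrees n) ∧
    ∃ π : PMF (BranchMerging.UnlabelledTree n),
      BranchMerging.IsStationary (BranchMerging.step hn) π ∧
      (∀ π' : PMF (BranchMerging.UnlabelledTree n), BranchMerging.IsStationary (BranchMerging.step hn) π' → π' = π) ∧
      π.support = BranchMerging.binaryTrees n ∧
      ∀ (μ : PMF (BranchMerging.UnlabelledTree n)) (y : BranchMerging.UnlabelledTree n),
        Filter.Tendsto (fun k => BranchMerging.law (BranchMerging.step hn) μ k y) Filter.atTop (nhds (π y)) := by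
  obtain ⟨x⟩ := BranchMerging.nonempty_unlabelledTree n
  -- Any binary tree `b` can serve as the reference state, as it has a loop and is accessible from
  -- everywhere.
  obtain ⟨b, hb, -⟩ := BranchMerging.exists_accessible_binaryTree hn x
  have hacc : ∀ x, BranchMerging.Accessible (BranchMerging.step hn) x b := by
    intro x
    obtain ⟨y, hy, hxy⟩ := BranchMerging.exists_accessible_binaryTree hn x
    exact hxy.trans (BranchMerging.accessible_binaryTrees hn hy hb)
  have hB : {y | BranchMerging.Accessible (BranchMerging.step hn) b y} =
      BranchMerging.binaryTrees n := by
    ext y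
    exact ⟨fun h => h.mem_of_closed
      (fun x hx y hxy => BranchMerging.mem_binaryTrees_of_step hn hx hxy) hb,
      fun h => BranchMerging.accessible_binaryTrees hn hb h⟩
  have := Fintype.ofFinite (BranchMerging.UnlabelledTree n)
  rw [← hB]
  exact ⟨BranchMerging.isCommunicatingClass_and_isClosedSet_iff hacc,
    BranchMerging.exists_stationary_tendsto hacc (BranchMerging.step_self_ne_zero hn b)⟩
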